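/- **Setting.** Let $\mathcal V$ be the semi-infinite wedge space, with its orthonormal basis of vectors $\underline{k_1}\wedge\underline{k_2}\wedge\cdots$ ($k_1>k_2>\cdots$ half-integers, $k_i+i$ eventually constant), let $\psi_i$ be the operator $\underline i\wedge\cdot$, let $\psi_i^\dagger$ be its adjoint, and put $E_{i,j}=\psi_i\psi_j^\dagger$ for $j>0$ and $E_{i,j}=-\psi_j^\dagger\psi_i$ for $j<0$. For $n\in\mathbb Z$ let $$\mathcal E_n(z)=\sum_{j\in\mathbb Z+\frac12}e^{z(j-\frac n2)}E_{j-n,j},\qquad \alpha_n=\mathcal E_n(0)$$ (for $n=0$ this is the operator without the constant term $1/(e^{z/2}-e^{-z/2})$, usually denoted $\tilde{\mathcal E}_0$). Write $\langle\,\cdot\,\rangle$ for the expectation in the vacuum $\underline{-\tfrac12}\wedge\underline{-\tfrac32}\wedge\cdots$. For positive integers $\mu_1,\dots,\mu_m$ and $\nu_1,\dots,\nu_n$, $k\in\mathbb Z$ and $r,s\ge 0$, the possibly disconnected $k$-leaky $(r+1)$-completed cycles Hurwitz number is $$h^{\wr,k,r,s}_{\mu,\nu}=\frac{1}{\prod_i\mu_i\prod_j\nu_j}\,[z_1^{r+1}\cdots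 z_s^{r+1}]\Big\langle\prod_{i=1}^m\alpha_{\mu_i}\prod_{p=1}^s\mathcal E_{-k}(z_p)\prod_{j=1}^n\alpha_{-\nu_j}\Big\rangle .$$ **Theorem.** Fix integers $m,n,r\ge 0$ and $s\ge 1$. In the real vector space $\{(x,y,k)\in\mathbb R^m\times\mathbb R^n\times\mathbb R:\ \sum_i x_i=\sum_j y_j+sk\}$ consider the walls $$\sum_{i\in I}x_i-\sum_{j\in J}y_j-kt=0,\qquad I\subseteq\{1,\dots,m\},\ J\subseteq\{1,\dots,n\},\ t=0,\dots,s,$$ where the two pairs $(I,J)=(\emptyset,\emptyset)$ and $(I,J)=(\{1,\dots,m\},\{1,\dots,n\})$ are omitted; in particular $k=0$ is not included as a wall. A chamber is a connected component of the complement of all walls. Then for every chamber $\mathfrak c$: 1. there is a polynomial $P_{\mathfrak c}$ with rational coefficients in $m+n+1$ variables such that $h^{\wr,k,r,s}_{\mu,\nu}=P_{\mathfrak c}(\mu,\nu,k)$ for all lattice points $(\mu,\nu,k)\in\mathfrak c$ with all $\mu_i,\nu_j$ positive integers and $k$ an integer $\ge 0$, the points with $k=0$ included; 2. likewise there is a polynomial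 $Q_{\mathfrak c}$ such that $h^{\wr,k,r,s}_{\mu,\nu}=Q_{\mathfrak c}(\mu,\nu,k)$ for all such lattice points of $\mathfrak c$ with $k\le 0$, the points with $k=0$ included. -/

import Mathlib

open scoped BigOperators

noncomputable section

namespace LeakyHurwitz

/-! ### The semi-infinite wedge space

The half-integer `a + 1/2` is encoded by the integer `a`, so that positive half-integers
correspond to `0 ≤ a` and negative ones to `a < 0`. -/

/-- A basis vector `k₁ ∧ k₂ ∧ ⋯` with `k₁ > k₂ > ⋯` half-integers such that `kᵢ + i` is
eventually constant, recorded as the set `{k₁, k₂, …}`: it contains finitely many positive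
half-integers and misses finitely many negative ones (the charge is arbitrary). -/
@[ext]
structure Maya where
  carrier : Set ℤ
  finite_pos : {a : ℤ | a ∈ carrier ∧ 0 ≤ a}.Finite
  finite_neg : {a : ℤ | a ∉ carrier ∧ a < 0}.Finite

/-- The vacuum `-1/2 ∧ -3/2 ∧ -5/2 ∧ ⋯`. -/
def Maya.vacuum : Maya where
  carrier := {a | a < 0}
  finite_pos := by
    convert Set.finite_empty (α := ℤ)
    ext a; simp
  finite_neg := by
    convert Set.finite_empty (α := ℤ)
    ext a; simp

/-- Add the factor `k`. -/
def Maya.insert (k : ℤ) (S : Maya) : Maya where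
  carrier := Insert.insert k S.carrier
  finite_pos := (S.finite_pos.insert k).subset (by
    rintro a ⟨rfl | h, h0⟩
    · exact Or.inl rfl
    · exact Or.inr ⟨h, h0⟩)
  finite_neg := S.finite_neg.subset (by
    rintro a ⟨h, h0⟩
    exact ⟨fun h' => h (Or.inr h'), h0⟩)

/-- Remove the factor `k`. -/
def Maya.erase (k : ℤ) (S : Maya) : Maya where
  carrier := S.carrier \ {k}
  finite_pos := S.finite_pos.subset (by
    rintro a ⟨h, h0⟩
    exact ⟨h.1, h0⟩)
  finite_neg := (S.finite_neg.insert k).subset (by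
    rintro a ⟨h, h0⟩
    by_cases hk : a = k
    · exact Or.inl hk
    · exact Or.inr ⟨fun h' => h ⟨h', hk⟩, h0⟩)

/-- The number of factors of the basis vector `S` which are larger than `k` (a finite number). -/
def Maya.numAbove (S : Maya) (k : ℤ) : ℕ := {a : ℤ | a ∈ S.carrier ∧ k < a}.ncard

/-- The semi-infinite wedge space with coefficients in `R`. -/
abbrev Fock (R : Type*) [CommRing R] : Type _ := Maya →₀ R

variable (R : Type*) [CommRing R]

open Classical in
/-- `ψ_k`, the wedge product with `k` from the left: moving `k` to its place among the
decreasing factors produces the sign. -/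
def psi (k : ℤ) : Module.End R (Fock R) :=
  Finsupp.linearCombination R fun S : Maya =>
    if k ∈ S.carrier then 0
    else Finsupp.single (S.insert k) ((-1 : R) ^ S.numAbove k)

open Classical in
/-- `ψ_k†`, the adjoint of `ψ_k` for the form in which the basis is orthonormal. -/
def psiDagger (k : ℤ) : Module.End R (Fock R) :=
  Finsupp.linearCombination R fun S : Maya =>
    if k ∈ S.carrier then Finsupp.single (S.erase k) ((-1 : R) ^ S.numAbove k)
    else 0

/-- The normally ordered products `E_{i,j}`. -/
def normalE (i j : ℤ) : Module.End R (Fock R) :=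
  if 0 ≤ j then psi R i * psiDagger R j else -(psiDagger R j * psi R i)

variable {R}

/-- The operator `∑_j w(j) E_{j-n,j}`, for a weight function `w`; on each basis vector all but
finitely many summands vanish. -/
def weightedE (w : ℤ → R) (n : ℤ) : Module.End R (Fock R) :=
  Finsupp.linearCombination R fun S : Maya =>
    ∑ᶠ j : ℤ, w j • normalE R (j - n) j (Finsupp.single S 1)

/-- The sum in `weightedE` is a finite sum. -/
theorem weightedE_finite (w : ℤ → R) (n : ℤ) (S : Maya) :
    (Function.support fun j : ℤ =>
      w j • normalE R (j - n) j (Finsupp.single S (1 : R))).Finite := by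
  have h1 : ((fun b : ℤ => b + n) '' ({b : ℤ | b ∉ S.carrier ∧ b < 0} ∪ Set.Icc 0 (-n))).Finite :=
    (S.finite_neg.union (Set.finite_Icc _ _)).image _
  refine (S.finite_pos.union h1).subset ?_
  intro j hj
  rw [Function.mem_support] at hj
  by_cases h0 : 0 ≤ j
  · left
    refine ⟨?_, h0⟩
    by_contra hS
    apply hj
    simp [normalE, h0, psiDagger, hS]
  · right
    refine ⟨j - n, ?_, by simp⟩
    have hS : j - n ∉ S.carrier := by
      intro hS
      apply hj
      simp [normalE, h0, psi, hS]
    by_cases hneg : j - n < 0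
    · exact Or.inl ⟨hS, hneg⟩
    · right
      constructor <;> omega

/-- `ψ†` is adjoint to `ψ`. -/
theorem psi_adjoint (k : ℤ) (S T : Maya) :
    psi R k (Finsupp.single S 1) T = psiDagger R k (Finsupp.single T 1) S := by
  classical
  by_cases hS : k ∈ S.carrier <;> by_cases hT : k ∈ T.carrier
  · have : T.erase k ≠ S := by
      rintro rfl
      simp [Maya.erase] at hS
    simp [psi, psiDagger, hS, hT, this]
  · simp [psi, psiDagger, hS, hT]
  · have hiff : S.insert k = T ↔ T.erase k = S := by
      constructor
      · rintro rfl
        ext a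
        by_cases ha : a = k
        · subst ha; simp [Maya.insert, Maya.erase, hS]
        · simp [Maya.insert, Maya.erase, ha]
      · rintro rfl
        ext a
        by_cases ha : a = k
        · subst ha; simp [Maya.insert, Maya.erase, hT]
        · simp [Maya.insert, Maya.erase, ha]
    simp only [psi, psiDagger, hS, hT, Finsupp.linearCombination_single, if_false, if_true,
      one_smul, Finsupp.single_apply, hiff]
    by_cases h : T.erase k = S
    · have h' := hiff.2 h
      subst h'
      have : (S.insert k).numAbove k = S.numAbove k := by
        unfold Maya.numAbove
        congr 1
        ext a
        simp only [Maya.insert, Set.mem_insert_iff, Set.mem_ofPred_eq]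
        constructor
        · rintro ⟨rfl | h1, h2⟩
          · exact absurd h2 (lt_irrefl _)
          · exact ⟨h1, h2⟩
        · rintro ⟨h1, h2⟩
          exact ⟨Or.inr h1, h2⟩
      rw [this]
    · simp [h]
  · have : S.insert k ≠ T := by
      rintro rfl
      simp [Maya.insert] at hT
    simp [psi, psiDagger, hS, hT, this]

/-- The vacuum expectation value `⟨0| O |0⟩`. -/
def vev (O : Module.End R (Fock R)) : R :=
  O (Finsupp.single Maya.vacuum 1) Maya.vacuum

/-- `α_n = ∑_k E_{k-n,k}`, the value at `z = 0` of the series `𝓔_n(z)`. -/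
def alpha (R : Type*) [CommRing R] (n : ℤ) : Module.End R (Fock R) :=
  weightedE (fun _ => (1 : R)) n

/-- The formal power series `exp (c z_p)` in the variables `z_1, …, z_s`. -/
def expVar {s : ℕ} (p : Fin s) (c : ℚ) : MvPowerSeries (Fin s) ℚ :=
  PowerSeries.subst (MvPowerSeries.X p : MvPowerSeries (Fin s) ℚ)
    (PowerSeries.rescale c (PowerSeries.exp ℚ))

/-- The operator `∑_k exp (z_p (k - n/2)) E_{k-n,k}`, the sum over half-integers `k = a + 1/2`.
It is `𝓔_n(z_p)` for `n ≠ 0`, and the operator `𝓔̃_0(z_p)`, which does not have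
the constant term `1 / ς(z_p)`, for `n = 0`. -/
def calE {s : ℕ} (n : ℤ) (p : Fin s) :
    Module.End (MvPowerSeries (Fin s) ℚ) (Fock (MvPowerSeries (Fin s) ℚ)) :=
  weightedE (fun a => expVar p ((a : ℚ) + 1 / 2 - (n : ℚ) / 2)) n

/-- The possibly disconnected `k`-leaky `(r+1)`-completed cycles Hurwitz number
`h^{≀,k,r,s}_{μ,ν}`. -/
def hurwitz {m n : ℕ} (s r : ℕ) (μ : Fin m → ℕ) (ν : Fin n → ℕ) (k : ℤ) : ℚ :=
  ((∏ i, (μ i : ℚ)) * ∏ j, (ν j : ℚ))⁻¹ *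
    MvPowerSeries.coeff (Finsupp.equivFunOnFinite.symm fun _ : Fin s => r + 1)
      (vev ((List.ofFn fun i => alpha (MvPowerSeries (Fin s) ℚ) (μ i : ℤ)).prod *
        (List.ofFn fun p : Fin s => calE (-k) p).prod *
        (List.ofFn fun j => alpha (MvPowerSeries (Fin s) ℚ) (-(ν j : ℤ))).prod))

/-! ### The hyperplane arrangement -/

/-- Real triples `(x, y, k)`. -/
abbrev Triple (m n : ℕ) : Type := (Fin m → ℝ) × (Fin n → ℝ) × ℝ

/-- The real vector space of all `(x, y, k)` with `∑ x_i = ∑ y_j + s k`. -/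
def balanced (m n s : ℕ) : Set (Triple m n) :=
  {p | ∑ i, p.1 i = ∑ j, p.2.1 j + (s : ℝ) * p.2.2}

/-- The hyperplane `x_I - y_J - k t = 0`. -/
def wall {m n : ℕ} (s : ℕ) (I : Finset (Fin m)) (J : Finset (Fin n)) (t : ℕ) :
    Set (Triple m n) :=
  {p | p ∈ balanced m n s ∧ ∑ i ∈ I, p.1 i - ∑ j ∈ J, p.2.1 j - p.2.2 * (t : ℝ) = 0}

/-- The complement of all walls. The pairs `(I, J)` with both `I` and `J` empty, or both full,
do not give walls: their equations read `t k = 0` and `(s - t) k = 0`. In particular, `k = 0` is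
not a wall. -/
def wallComplement (m n s : ℕ) : Set (Triple m n) :=
  {p | p ∈ balanced m n s ∧ ∀ (I : Finset (Fin m)) (J : Finset (Fin n)) (t : ℕ),
    ¬ (I = ∅ ∧ J = ∅) → ¬ (I = Finset.univ ∧ J = Finset.univ) → t ≤ s → p ∉ wall s I J t}

/-- `C` is a chamber: a connected component of the complement of the walls. -/
def IsChamber (m n s : ℕ) (C : Set (Triple m n)) : Prop :=
  ∃ p ∈ wallComplement m n s, C = connectedComponentIn (wallComplement m n s) p

/-- The lattice points of the domain: positive parts, and `|μ| = |ν| + s k`. -/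
def IsLatticePoint {m n : ℕ} (s : ℕ) (μ : Fin m → ℕ) (ν : Fin n → ℕ) (k : ℤ) : Prop :=
  (∀ i, 0 < μ i) ∧ (∀ j, 0 < ν j) ∧ (∑ i, (μ i : ℤ)) = (∑ j, (ν j : ℤ)) + (s : ℤ) * k

/-- The real triple of a lattice point. -/
def toTriple {m n : ℕ} (μ : Fin m → ℕ) (ν : Fin n → ℕ) (k : ℤ) : Triple m n :=
  (fun i => (μ i : ℝ), fun j => (ν j : ℝ), (k : ℝ))

/-- The value of a polynomial in `x_1, …, x_m, y_1, …, y_n, k` at `(μ, ν, k)`. -/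
def evalAt {m n : ℕ} (P : MvPolynomial (Fin m ⊕ Fin n ⊕ Unit) ℚ)
    (μ : Fin m → ℕ) (ν : Fin n → ℕ) (k : ℤ) : ℚ :=
  MvPolynomial.eval
    (Sum.elim (fun i => (μ i : ℚ)) (Sum.elim (fun j => (ν j : ℚ)) fun _ => (k : ℚ))) P

end LeakyHurwitz

end

/-!
The Hurwitz numbers are polynomial on chambers because the vacuum expectation value which defines
them can be computed by commuting operators, and on a chamber every computation follows the same
pattern.

For a set `P` of the variables let `z_P` be their sum, and let `𝓔_a(z_P)` be the operator `blockOp`;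
the operators `α_a` are the case `P = ∅`. For disjoint `P` and `Q`,
`[𝓔_a(z_P), 𝓔_b(z_Q)] = ς(a z_Q - b z_P) 𝓔_{a+b}(z_{P ∪ Q}) + δ_{a+b,0} ς(a z_{P ∪ Q}) / ς(z_{P ∪ Q})`
with `ς(z) = exp(z/2) - exp(-z/2)` (`blockOp_comm_apply`). This follows from
`weightedE_mul_weightedE`: both sides have the same commutators with the fermions `ψ_k` and `ψ_k†`,
an operator commuting with all fermions is a scalar (`eq_vev_smul_one_of_commute`), and the scalar
can be read off from the vacuum.

Starting from the product of all operators, one moves an operator of energy `≥ 0` to the right until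
it kills the vacuum. Each exchange merges two operators, and the merged operators correspond to the
blocks of a set partition of the factors. A block with the factors `I`, `J` and `t` of the operators
`𝓔_{-k}` has energy `μ_I - ν_J - k t`, the form which defines a wall, so for `(I, J)` neither empty
nor full it has a constant nonzero sign on a chamber (`chamber_sign`). For `(I, J)` empty or full the
energy is `-t k` or `(s - t) k`, whose sign is constant once the sign of `k` is fixed
(`energy_sign`). Hence the same exchanges work at all lattice points, including those with `k = 0`,
where these last energies vanish. The central term contributes only when the two last blocks
merge: whenever a proper block has energy zero, one has `k = 0`, and either the central term or the
remaining vacuum expectation value vanishes (`energy_eq_zero`).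

It remains to see that the coefficients are polynomials in the energies, and that the product of the
`μ_i` and `ν_j` cancels. Polynomiality is expressed by `CoeffIn`, for the algebra of polynomial
functions on the lattice points considered. A commutator with `α_a` has the factor `ς(a z)`
or `ς(a z) / ς(z)`, and both are divisible by `a` (`exists_expSum_sub`, `exists_sum_expSum`, the
latter by Faulhaber's formula); the exchange of two operators `α` contributes nothing. The induction
over all of this is `exists_corr`.
-/

noncomputable section

namespace LeakyHurwitz

section Fock

variable {R : Type*} [CommRing R]

/-! ### Canonical anticommutation relations -/

theorem Maya.finite_above (S : Maya) (k : ℤ) : {a : ℤ | a ∈ S.carrier ∧ k < a}.Finite := by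
  refine (S.finite_pos.union (Set.finite_Ioc k 0)).subset ?_
  rintro a ⟨h1, h2⟩
  by_cases h : 0 ≤ a
  · exact Or.inl ⟨h1, h⟩
  · exact Or.inr ⟨h2, by omega⟩

theorem Maya.insert_comm (k l : ℤ) (S : Maya) : (S.insert l).insert k = (S.insert k).insert l := by
  ext a; simp only [Maya.insert]; rw [Set.insert_comm]

theorem Maya.insert_erase {k : ℤ} {S : Maya} (h : k ∈ S.carrier) : (S.erase k).insert k = S := by
  ext a
  simp only [Maya.insert, Maya.erase, Set.mem_insert_iff, Set.mem_sdiff, Set.mem_singleton_iff]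
  by_cases ha : a = k <;> simp [ha, h]

theorem Maya.erase_insert {k : ℤ} {S : Maya} (h : k ∉ S.carrier) : (S.insert k).erase k = S := by
  ext a
  simp only [Maya.insert, Maya.erase, Set.mem_insert_iff, Set.mem_sdiff, Set.mem_singleton_iff]
  by_cases ha : a = k <;> simp [ha, h]

theorem Maya.mem_insert {k a : ℤ} {S : Maya} :
    a ∈ (S.insert k).carrier ↔ a = k ∨ a ∈ S.carrier := Iff.rfl

theorem Maya.mem_erase {k a : ℤ} {S : Maya} :
    a ∈ (S.erase k).carrier ↔ a ∈ S.carrier ∧ a ≠ k := Iff.rfl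

theorem Maya.mem_vacuum {a : ℤ} : a ∈ Maya.vacuum.carrier ↔ a < 0 := Iff.rfl

theorem Maya.erase_insert_comm {k l : ℤ} (hkl : k ≠ l) (S : Maya) :
    (S.insert l).erase k = (S.erase k).insert l := by
  ext a
  simp only [Maya.mem_insert, Maya.mem_erase]
  by_cases ha : a = l
  · subst ha; simp [Ne.symm hkl]
  · simp [ha]

/-- The sign picked up when a factor `k` is moved to its place in `S`. -/
def Maya.sign (R : Type*) [CommRing R] (S : Maya) (k : ℤ) : R := (-1) ^ S.numAbove k

theorem Maya.sign_mul_self (S : Maya) (k : ℤ) : S.sign R k * S.sign R k = 1 := by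
  rw [Maya.sign, ← mul_pow]; simp

theorem Maya.sign_insert_self (S : Maya) (k : ℤ) : (S.insert k).sign R k = S.sign R k := by
  unfold Maya.sign Maya.numAbove
  congr 2
  ext a
  simp only [Maya.mem_insert, Set.mem_ofPred_eq]
  constructor
  · rintro ⟨rfl | h1, h2⟩
    · exact absurd h2 (lt_irrefl _)
    · exact ⟨h1, h2⟩
  · rintro ⟨h1, h2⟩
    exact ⟨Or.inr h1, h2⟩

theorem Maya.sign_insert {S : Maya} {l : ℤ} (hl : l ∉ S.carrier) (k : ℤ) :
    (S.insert l).sign R k = S.sign R k * if k < l then -1 else 1 := by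
  unfold Maya.sign
  split_ifs with h
  · have : {a : ℤ | a ∈ (S.insert l).carrier ∧ k < a} =
        Insert.insert l {a : ℤ | a ∈ S.carrier ∧ k < a} := by
      ext a
      simp only [Maya.mem_insert, Set.mem_ofPred_eq, Set.mem_insert_iff]
      constructor
      · rintro ⟨rfl | h1, h2⟩
        · exact Or.inl rfl
        · exact Or.inr ⟨h1, h2⟩
      · rintro (rfl | ⟨h1, h2⟩)
        · exact ⟨Or.inl rfl, h⟩
        · exact ⟨Or.inr h1, h2⟩
    unfold Maya.numAbove
    rw [this, Set.ncard_insert_of_notMem (by simp [hl]) (S.finite_above k), pow_succ]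
  · have : {a : ℤ | a ∈ (S.insert l).carrier ∧ k < a} = {a : ℤ | a ∈ S.carrier ∧ k < a} := by
      ext a
      simp only [Maya.mem_insert, Set.mem_ofPred_eq]
      constructor
      · rintro ⟨rfl | h1, h2⟩
        · exact absurd h2 h
        · exact ⟨h1, h2⟩
      · rintro ⟨h1, h2⟩
        exact ⟨Or.inr h1, h2⟩
    unfold Maya.numAbove
    rw [this, mul_one]

theorem Maya.sign_erase {S : Maya} {l : ℤ} (hl : l ∈ S.carrier) (k : ℤ) :
    (S.erase l).sign R k = S.sign R k * if k < l then -1 else 1 := by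
  have h := Maya.sign_insert (R := R) (S := S.erase l) (l := l) (by simp [Maya.mem_erase]) k
  rw [Maya.insert_erase hl] at h
  rw [h]
  split_ifs <;> simp

theorem Maya.sign_erase_self {S : Maya} {k : ℤ} (hk : k ∈ S.carrier) :
    (S.erase k).sign R k = S.sign R k := by
  rw [Maya.sign_erase hk]; simp

/-- The basis vector of the wedge space given by `S`. -/
def ket (R : Type*) [CommRing R] (S : Maya) : Fock R := Finsupp.single S 1

theorem End_ext {A B : Module.End R (Fock R)} (h : ∀ S, A (ket R S) = B (ket R S)) : A = B :=
  Finsupp.lhom_ext' fun S => LinearMap.ext_ring (h S)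

theorem psi_ket_mem {k : ℤ} {S : Maya} (h : k ∈ S.carrier) : psi R k (ket R S) = 0 := by
  simp [psi, ket, h]

theorem psi_ket_notMem {k : ℤ} {S : Maya} (h : k ∉ S.carrier) :
    psi R k (ket R S) = S.sign R k • ket R (S.insert k) := by
  simp [psi, ket, h, Maya.sign]

theorem psiDagger_ket_mem {k : ℤ} {S : Maya} (h : k ∈ S.carrier) :
    psiDagger R k (ket R S) = S.sign R k • ket R (S.erase k) := by
  simp [psiDagger, ket, h, Maya.sign]

theorem psiDagger_ket_notMem {k : ℤ} {S : Maya} (h : k ∉ S.carrier) :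
    psiDagger R k (ket R S) = 0 := by
  simp [psiDagger, ket, h]

theorem psi_mul_psi (k l : ℤ) : psi R k * psi R l = -(psi R l * psi R k) := by
  refine End_ext fun S => ?_
  simp only [Module.End.mul_apply, LinearMap.neg_apply]
  by_cases hkl : k = l
  · subst hkl
    by_cases hS : k ∈ S.carrier
    · simp [psi_ket_mem hS]
    · simp [psi_ket_notMem hS, psi_ket_mem (show k ∈ (S.insert k).carrier from Or.inl rfl)]
  by_cases hk : k ∈ S.carrier <;> by_cases hl : l ∈ S.carrier
  · simp [psi_ket_mem hk, psi_ket_mem hl]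
  · simp [psi_ket_mem hk, psi_ket_notMem hl,
      psi_ket_mem (show k ∈ (S.insert l).carrier from Or.inr hk)]
  · simp [psi_ket_mem hl, psi_ket_notMem hk,
      psi_ket_mem (show l ∈ (S.insert k).carrier from Or.inr hl)]
  · have h1 : k ∉ (S.insert l).carrier := by simp [Maya.mem_insert, hkl, hk]
    have h2 : l ∉ (S.insert k).carrier := by simp [Maya.mem_insert, Ne.symm hkl, hl]
    simp only [psi_ket_notMem hl, psi_ket_notMem hk, map_smul, psi_ket_notMem h1,
      psi_ket_notMem h2, Maya.sign_insert hl, Maya.sign_insert hk, smul_smul,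
      Maya.insert_comm k l, ← neg_smul]
    congr 1
    rcases lt_or_gt_of_ne hkl with h | h
    · simp [h, h.not_gt, mul_comm]
    · simp [h, h.not_gt, mul_comm]

theorem psiDagger_mul_psiDagger (k l : ℤ) :
    psiDagger R k * psiDagger R l = -(psiDagger R l * psiDagger R k) := by
  refine End_ext fun S => ?_
  simp only [Module.End.mul_apply, LinearMap.neg_apply]
  by_cases hkl : k = l
  · subst hkl
    by_cases hS : k ∈ S.carrier
    · simp [psiDagger_ket_mem hS,
        psiDagger_ket_notMem (show k ∉ (S.erase k).carrier from fun h => h.2 rfl)]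
    · simp [psiDagger_ket_notMem hS]
  by_cases hk : k ∈ S.carrier <;> by_cases hl : l ∈ S.carrier
  · have h1 : k ∈ (S.erase l).carrier := ⟨hk, hkl⟩
    have h2 : l ∈ (S.erase k).carrier := ⟨hl, Ne.symm hkl⟩
    have h3 : (S.erase l).erase k = (S.erase k).erase l := by
      ext a; simp only [Maya.mem_erase]; tauto
    simp only [psiDagger_ket_mem hl, psiDagger_ket_mem hk, map_smul, psiDagger_ket_mem h1,
      psiDagger_ket_mem h2, Maya.sign_erase hl, Maya.sign_erase hk, smul_smul, h3, ← neg_smul]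
    congr 1
    rcases lt_or_gt_of_ne hkl with h | h
    · simp [h, h.not_gt, mul_comm]
    · simp [h, h.not_gt, mul_comm]
  · simp [psiDagger_ket_mem hk, psiDagger_ket_notMem hl,
      psiDagger_ket_notMem (show l ∉ (S.erase k).carrier from fun h => hl h.1)]
  · simp [psiDagger_ket_mem hl, psiDagger_ket_notMem hk,
      psiDagger_ket_notMem (show k ∉ (S.erase l).carrier from fun h => hk h.1)]
  · simp [psiDagger_ket_notMem hk, psiDagger_ket_notMem hl]

theorem psi_mul_psiDagger_self_ket_mem {k : ℤ} {S : Maya} (h : k ∈ S.carrier) :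
    (psi R k * psiDagger R k) (ket R S) = ket R S := by
  rw [Module.End.mul_apply, psiDagger_ket_mem h, map_smul,
    psi_ket_notMem (show k ∉ (S.erase k).carrier from fun h => h.2 rfl), smul_smul,
    Maya.insert_erase h, Maya.sign_erase_self h, Maya.sign_mul_self, one_smul]

theorem psi_mul_psiDagger_self_ket_notMem {k : ℤ} {S : Maya} (h : k ∉ S.carrier) :
    (psi R k * psiDagger R k) (ket R S) = 0 := by
  rw [Module.End.mul_apply, psiDagger_ket_notMem h, map_zero]

theorem psiDagger_mul_psi (k l : ℤ) :
    psiDagger R k * psi R l = (if k = l then 1 else 0) - psi R l * psiDagger R k := by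
  refine End_ext fun S => ?_
  by_cases hkl : k = l
  · subst hkl
    simp only [if_true, LinearMap.sub_apply, Module.End.one_apply]
    by_cases hS : k ∈ S.carrier
    · rw [psi_mul_psiDagger_self_ket_mem hS, Module.End.mul_apply, psi_ket_mem hS]; simp
    · rw [psi_mul_psiDagger_self_ket_notMem hS, Module.End.mul_apply, psi_ket_notMem hS, map_smul,
        psiDagger_ket_mem (show k ∈ (S.insert k).carrier from Or.inl rfl), smul_smul,
        Maya.erase_insert hS, Maya.sign_insert_self, Maya.sign_mul_self]
      simp
  simp only [if_neg hkl, LinearMap.sub_apply, Module.End.mul_apply, LinearMap.zero_apply, zero_sub]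
  by_cases hk : k ∈ S.carrier <;> by_cases hl : l ∈ S.carrier
  · simp [psiDagger_ket_mem hk, psi_ket_mem hl,
      psi_ket_mem (show l ∈ (S.erase k).carrier from ⟨hl, Ne.symm hkl⟩)]
  · have h1 : k ∈ (S.insert l).carrier := Or.inr hk
    have h2 : l ∉ (S.erase k).carrier := fun h => hl h.1
    simp only [psiDagger_ket_mem hk, psi_ket_notMem hl, map_smul, psiDagger_ket_mem h1,
      psi_ket_notMem h2, Maya.sign_insert hl, Maya.sign_erase hk, smul_smul,
      Maya.erase_insert_comm hkl, ← neg_smul]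
    congr 1
    rcases lt_or_gt_of_ne hkl with h | h
    · simp [h, h.not_gt, mul_comm]
    · simp [h, h.not_gt, mul_comm]
  · simp [psiDagger_ket_notMem hk, psi_ket_mem hl]
  · simp [psiDagger_ket_notMem hk, psi_ket_notMem hl, psiDagger_ket_notMem
      (show k ∉ (S.insert l).carrier from fun h => h.elim hkl hk)]

/-- Normal ordering subtracts the vacuum expectation value. -/
theorem normalE_eq (i j : ℤ) :
    normalE R i j = psi R i * psiDagger R j - if i = j ∧ j < 0 then 1 else 0 := by
  unfold normalE
  split_ifs with h h' h'
  · omega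
  · exact (sub_zero (G := Module.End R (Fock R)) _).symm
  · rw [psiDagger_mul_psi, if_pos h'.1.symm]
    exact neg_sub (α := Module.End R (Fock R)) _ _
  · rw [psiDagger_mul_psi, if_neg (by omega)]
    exact neg_sub (α := Module.End R (Fock R)) _ _

theorem mul_mul_sub_of_anticomm_right {A : Type*} [Ring A] {a b c e : A} (h1 : b * c = e - c * b)
    (h2 : c * a = -(a * c)) : a * b * c - c * (a * b) = a * e := by
  rw [mul_assoc, h1, ← mul_assoc c, h2]; noncomm_ring

theorem mul_mul_sub_of_anticomm_left {A : Type*} [Ring A] {a b c e : A} (h1 : c * a = e - a * c)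
    (h2 : b * c = -(c * b)) : a * b * c - c * (a * b) = -(e * b) := by
  rw [mul_assoc, h2, ← mul_assoc c, h1]; noncomm_ring

theorem sub_ite_one_mul_sub {A : Type*} [Ring A] (x y : A) (p : Prop) [Decidable p] :
    (x - if p then 1 else 0) * y - y * (x - if p then 1 else 0) = x * y - y * x := by
  split_ifs <;> noncomm_ring

theorem normalE_mul_psi (i j k : ℤ) :
    normalE R i j * psi R k - psi R k * normalE R i j = if j = k then psi R i else 0 := by
  rw [normalE_eq]
  refine (sub_ite_one_mul_sub (A := Module.End R (Fock R)) _ _ _).trans ((mul_mul_sub_of_anticomm_right (A := Module.End R (Fock R))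
    (psiDagger_mul_psi (R := R) j k) (psi_mul_psi (R := R) k i)).trans ?_)
  split_ifs
  · exact mul_one _
  · exact mul_zero _

theorem normalE_mul_psiDagger (i j k : ℤ) :
    normalE R i j * psiDagger R k - psiDagger R k * normalE R i j =
      if i = k then -psiDagger R j else 0 := by
  rw [normalE_eq]
  refine (sub_ite_one_mul_sub (A := Module.End R (Fock R)) _ _ _).trans ((mul_mul_sub_of_anticomm_left (A := Module.End R (Fock R))
    (psiDagger_mul_psi (R := R) k i) (psiDagger_mul_psiDagger (R := R) j k)).trans ?_)
  by_cases h : i = k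
  · rw [if_pos h, if_pos h.symm]
    exact congrArg _ (one_mul _)
  · rw [if_neg h, if_neg (Ne.symm h)]
    exact (congrArg _ (zero_mul _)).trans (neg_zero (G := Module.End R (Fock R)))

/-! ### Operators commuting with all fermions -/

/-- An operator which commutes with all fermions commutes with the occupation numbers `ψ_k ψ_k†`,
whose joint eigenspaces are spanned by the basis vectors; hence it is diagonal. -/
theorem apply_eq_zero_of_commute {D : Module.End R (Fock R)}
    (h1 : ∀ k, D * psi R k = psi R k * D) (h2 : ∀ k, D * psiDagger R k = psiDagger R k * D)
    {S T : Maya} (hST : S ≠ T) : D (ket R S) T = 0 := by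
  -- `ψ_k ψ_k†` multiplies the coefficient of `T` by the indicator of `k ∈ T`
  have diag : ∀ (k : ℤ) (v : Fock R), (k ∈ T.carrier → (psi R k * psiDagger R k) v T = v T) ∧
      (k ∉ T.carrier → (psi R k * psiDagger R k) v T = 0) := by
    intro k v
    induction v using Finsupp.induction_linear with
    | zero => simp
    | add f g hf hg =>
      refine ⟨fun h => ?_, fun h => ?_⟩
      · rw [map_add, Finsupp.add_apply, hf.1 h, hg.1 h, Finsupp.add_apply]
      · rw [map_add, Finsupp.add_apply, hf.2 h, hg.2 h, add_zero]
    | single U c =>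
      have hU : (Finsupp.single U c : Fock R) = c • ket R U := by simp [ket]
      rw [hU, map_smul]
      by_cases hk : k ∈ U.carrier
      · rw [psi_mul_psiDagger_self_ket_mem hk]
        refine ⟨fun _ => rfl, fun h => ?_⟩
        have : U ≠ T := by rintro rfl; exact h hk
        simp [ket, this]
      · rw [psi_mul_psiDagger_self_ket_notMem hk]
        refine ⟨fun h => ?_, fun h => by simp⟩
        have : U ≠ T := by rintro rfl; exact hk h
        simp [ket, this]
  have comm : ∀ k, D ((psi R k * psiDagger R k) (ket R S)) =
      (psi R k * psiDagger R k) (D (ket R S)) := by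
    intro k
    rw [← Module.End.mul_apply, ← Module.End.mul_apply, ← mul_assoc, h1, mul_assoc, h2, mul_assoc]
  obtain ⟨k, hk⟩ : ∃ k, ¬ (k ∈ S.carrier ↔ k ∈ T.carrier) := by
    by_contra! h
    exact hST (Maya.ext (Set.ext h))
  have hc := congrArg (fun v : Fock R => v T) (comm k)
  by_cases hS : k ∈ S.carrier
  · have hT : k ∉ T.carrier := fun h => hk ⟨fun _ => h, fun _ => hS⟩
    rw [psi_mul_psiDagger_self_ket_mem hS] at hc
    exact hc.trans ((diag k _).2 hT)
  · have hT : k ∈ T.carrier := by by_contra h; exact hk ⟨fun h' => absurd h' hS, fun h' => absurd h' h⟩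
    rw [psi_mul_psiDagger_self_ket_notMem hS, map_zero] at hc
    exact ((diag k _).1 hT).symm.trans hc.symm

/-- Irreducibility of the Fock space: an operator which commutes with all fermions is the
multiplication by its vacuum expectation value. -/
theorem eq_vev_smul_one_of_commute {D : Module.End R (Fock R)}
    (h1 : ∀ k, D * psi R k = psi R k * D) (h2 : ∀ k, D * psiDagger R k = psiDagger R k * D) :
    D = vev D • 1 := by
  have diag : ∀ S, D (ket R S) = D (ket R S) S • ket R S := by
    intro S
    ext T
    by_cases h : S = T
    · subst h; simp [ket]
    · rw [apply_eq_zero_of_commute h1 h2 h]; simp [ket, h]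
  -- `ψ_k` intertwines the eigenvalues at `S` and at `S.insert k`
  have step : ∀ (S : Maya) (k : ℤ), k ∉ S.carrier →
      D (ket R (S.insert k)) (S.insert k) = D (ket R S) S := by
    intro S k hk
    have h := congrArg (fun v : Fock R => S.sign R k * v (S.insert k))
      (LinearMap.congr_fun (h1 k) (ket R S))
    simp only [Module.End.mul_apply, psi_ket_notMem hk, map_smul] at h
    rw [diag S, map_smul, psi_ket_notMem hk] at h
    simpa [ket, ← mul_assoc, Maya.sign_mul_self, mul_comm, mul_left_comm] using h
  -- induction on the number of factors in which `S` differs from the vacuum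
  have all : ∀ (N : ℕ) (S : Maya), {a : ℤ | a ∈ S.carrier ∧ 0 ≤ a}.ncard +
      {a : ℤ | a ∉ S.carrier ∧ a < 0}.ncard = N →
      D (ket R S) S = vev D := by
    intro N
    induction N using Nat.strong_induction_on with
    | _ N ih =>
      intro S hN
      by_cases hp : ∃ k, k ∈ S.carrier ∧ 0 ≤ k
      · obtain ⟨k, hk, hk0⟩ := hp
        have hlt : {a : ℤ | a ∈ (S.erase k).carrier ∧ 0 ≤ a}.ncard <
            {a : ℤ | a ∈ S.carrier ∧ 0 ≤ a}.ncard := by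
          refine Set.ncard_lt_ncard ⟨fun a h => ⟨h.1.1, h.2⟩, fun h => ?_⟩ S.finite_pos
          exact (h (show k ∈ {a : ℤ | a ∈ S.carrier ∧ 0 ≤ a} from ⟨hk, hk0⟩)).1.2 rfl
        have heq : {a : ℤ | a ∉ (S.erase k).carrier ∧ a < 0} =
            {a : ℤ | a ∉ S.carrier ∧ a < 0} := by
          ext a
          simp only [Maya.mem_erase, Set.mem_ofPred_eq]
          constructor
          · rintro ⟨h, h'⟩; exact ⟨fun h'' => h ⟨h'', by omega⟩, h'⟩
          · rintro ⟨h, h'⟩; exact ⟨fun h'' => h h''.1, h'⟩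
        have := step (S.erase k) k (fun h => h.2 rfl)
        rw [Maya.insert_erase hk] at this
        rw [this]
        exact ih _ (by rw [heq]; omega) _ rfl
      by_cases hn : ∃ k, k ∉ S.carrier ∧ k < 0
      · obtain ⟨k, hk, hk0⟩ := hn
        have hlt : {a : ℤ | a ∉ (S.insert k).carrier ∧ a < 0}.ncard <
            {a : ℤ | a ∉ S.carrier ∧ a < 0}.ncard := by
          refine Set.ncard_lt_ncard ⟨fun a h => ⟨fun h' => h.1 (Or.inr h'), h.2⟩, fun h => ?_⟩
            S.finite_neg
          exact (h (show k ∈ {a : ℤ | a ∉ S.carrier ∧ a < 0} from ⟨hk, hk0⟩)).1 (Or.inl rfl)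
        have heq : {a : ℤ | a ∈ (S.insert k).carrier ∧ 0 ≤ a} =
            {a : ℤ | a ∈ S.carrier ∧ 0 ≤ a} := by
          ext a
          simp only [Maya.mem_insert, Set.mem_ofPred_eq]
          constructor
          · rintro ⟨h | h, h'⟩
            · omega
            · exact ⟨h, h'⟩
          · rintro ⟨h, h'⟩; exact ⟨Or.inr h, h'⟩
        rw [← step S k hk]
        exact ih _ (by rw [heq]; omega) _ rfl
      · have : S = Maya.vacuum := by
          ext a
          rw [Maya.mem_vacuum]
          constructor
          · intro h; by_contra h'; exact hp ⟨a, h, by omega⟩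
          · intro h; by_contra h'; exact hn ⟨a, h', h⟩
        rw [this]; rfl
  refine End_ext fun S => ?_
  rw [diag S, all _ S rfl]
  rfl

/-! ### Commutators of weighted sums of normally ordered products -/

theorem weightedE_support_finite (w : ℤ → R) (n : ℤ) (v : Fock R) :
    (Function.support fun j : ℤ => w j • normalE R (j - n) j v).Finite := by
  induction v using Finsupp.induction_linear with
  | zero => simp
  | add f g hf hg =>
    refine (hf.union hg).subset fun j hj => ?_
    by_contra h
    simp only [Set.mem_union, Function.mem_support, not_or, not_not] at h
    apply hj
    simp only [map_add, smul_add]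
    rw [h.1, h.2, add_zero]
  | single S c =>
    refine (weightedE_finite w n S).subset fun j hj => ?_
    rw [Function.mem_support] at hj ⊢
    intro h
    apply hj
    have : (Finsupp.single S c : Fock R) = c • Finsupp.single S 1 := by simp
    rw [this, map_smul, smul_comm, h, smul_zero]

theorem weightedE_ket (w : ℤ → R) (n : ℤ) (S : Maya) :
    weightedE w n (ket R S) = ∑ᶠ j : ℤ, w j • normalE R (j - n) j (ket R S) := by
  simp [weightedE, ket]

theorem weightedE_apply (w : ℤ → R) (n : ℤ) (v : Fock R) :
    weightedE w n v = ∑ᶠ j : ℤ, w j • normalE R (j - n) j v := by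
  induction v using Finsupp.induction_linear with
  | zero => simp
  | add f g hf hg =>
    simp only [map_add, smul_add]
    rw [finsum_add_distrib (weightedE_support_finite w n f) (weightedE_support_finite w n g),
      hf, hg]
  | single S c =>
    have : (Finsupp.single S c : Fock R) = c • ket R S := by simp [ket]
    simp only [this, map_smul, weightedE_ket, smul_comm _ c]
    exact smul_finsum' c (weightedE_support_finite w n _)

/-- Commutators with `∑_j w(j) E_{j-n,j}` can be computed term by term. -/
theorem weightedE_comm_apply (w : ℤ → R) (n : ℤ) (A : Module.End R (Fock R)) (v : Fock R) :
    weightedE w n (A v) - A (weightedE w n v) =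
      ∑ᶠ j : ℤ, w j • (normalE R (j - n) j (A v) - A (normalE R (j - n) j v)) := by
  have h : A (weightedE w n v) = ∑ᶠ j : ℤ, A (w j • normalE R (j - n) j v) := by
    rw [weightedE_apply]
    exact A.toAddMonoidHom.map_finsum (weightedE_support_finite w n v)
  rw [h, weightedE_apply, ← finsum_sub_distrib (weightedE_support_finite w n _)]
  · simp only [map_smul, smul_sub]
  · refine (weightedE_support_finite w n v).subset fun j hj => ?_
    rw [Function.mem_support] at hj ⊢
    intro h
    exact hj (by rw [h, map_zero])

theorem weightedE_psi_apply (w : ℤ → R) (n k : ℤ) (v : Fock R) :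
    weightedE w n (psi R k v) = psi R k (weightedE w n v) + w k • psi R (k - n) v := by
  rw [← sub_eq_iff_eq_add', weightedE_comm_apply, finsum_eq_single _ k]
  · have h := LinearMap.congr_fun (normalE_mul_psi (R := R) (k - n) k k) v
    rw [if_pos rfl] at h
    exact congrArg _ h
  · intro j hj
    have h := LinearMap.congr_fun (normalE_mul_psi (R := R) (j - n) j k) v
    rw [if_neg hj] at h
    exact (congrArg _ h).trans (smul_zero _)

theorem weightedE_psiDagger_apply (w : ℤ → R) (n k : ℤ) (v : Fock R) :
    weightedE w n (psiDagger R k v) =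
      psiDagger R k (weightedE w n v) - w (k + n) • psiDagger R (k + n) v := by
  rw [sub_eq_add_neg, ← sub_eq_iff_eq_add', weightedE_comm_apply, finsum_eq_single _ (k + n)]
  · have h := LinearMap.congr_fun (normalE_mul_psiDagger (R := R) (k + n - n) (k + n) k) v
    rw [if_pos (by omega)] at h
    exact (congrArg _ h).trans (smul_neg _ _)
  · intro j hj
    have h := LinearMap.congr_fun (normalE_mul_psiDagger (R := R) (j - n) j k) v
    rw [if_neg (by omega)] at h
    exact (congrArg _ h).trans (smul_zero _)

theorem psi_apply_notMem {k : ℤ} {T : Maya} (h : k ∉ T.carrier) (v : Fock R) :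
    psi R k v T = 0 := by
  induction v using Finsupp.induction_linear with
  | zero => simp
  | add f g hf hg => rw [map_add, Finsupp.add_apply, hf, hg, add_zero]
  | single S c =>
    have hS : (Finsupp.single S c : Fock R) = c • ket R S := by simp [ket]
    rw [hS, map_smul, Finsupp.smul_apply]
    by_cases hk : k ∈ S.carrier
    · rw [psi_ket_mem hk]; simp
    · have : S.insert k ≠ T := by rintro rfl; exact h (Or.inl rfl)
      rw [psi_ket_notMem hk]; simp [ket, this]

theorem psiDagger_apply_mem {k : ℤ} {T : Maya} (h : k ∈ T.carrier) (v : Fock R) :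
    psiDagger R k v T = 0 := by
  induction v using Finsupp.induction_linear with
  | zero => simp
  | add f g hf hg => rw [map_add, Finsupp.add_apply, hf, hg, add_zero]
  | single S c =>
    have hS : (Finsupp.single S c : Fock R) = c • ket R S := by simp [ket]
    rw [hS, map_smul, Finsupp.smul_apply]
    by_cases hk : k ∈ S.carrier
    · have : S.erase k ≠ T := by rintro rfl; exact h.2 rfl
      rw [psiDagger_ket_mem hk]; simp [ket, this]
    · rw [psiDagger_ket_notMem hk]; simp

/-- The operators of energy `n ≥ 0` kill the vacuum. -/
theorem weightedE_vacuum (w : ℤ → R) {n : ℤ} (hn : 0 ≤ n) :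
    weightedE w n (ket R Maya.vacuum) = 0 := by
  rw [weightedE_apply]
  refine finsum_eq_zero_of_forall_eq_zero fun j => ?_
  have : normalE R (j - n) j (ket R Maya.vacuum) = 0 := by
    unfold normalE
    split_ifs with hj
    · rw [Module.End.mul_apply, psiDagger_ket_notMem (by rw [Maya.mem_vacuum]; omega), map_zero]
    · rw [LinearMap.neg_apply, Module.End.mul_apply,
        psi_ket_mem (by rw [Maya.mem_vacuum]; omega), map_zero, neg_zero]
  rw [this, smul_zero]

/-- The operators of energy `n ≤ 0` kill the covacuum. -/
theorem weightedE_apply_vacuum (w : ℤ → R) {n : ℤ} (hn : n ≤ 0) (v : Fock R) :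
    weightedE w n v Maya.vacuum = 0 := by
  have key : ∀ j, (w j • normalE R (j - n) j v) Maya.vacuum = 0 := by
    intro j
    rw [Finsupp.smul_apply]
    unfold normalE
    split_ifs with hj
    · rw [Module.End.mul_apply, psi_apply_notMem (by rw [Maya.mem_vacuum]; omega), smul_zero]
    · rw [LinearMap.neg_apply, Module.End.mul_apply, Finsupp.neg_apply,
        psiDagger_apply_mem (by rw [Maya.mem_vacuum]; omega), neg_zero, smul_zero]
  rw [weightedE_apply]
  have := (Finsupp.applyAddHom (M := R) Maya.vacuum).map_finsum (weightedE_support_finite w n v)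
  exact this.trans (finsum_eq_zero_of_forall_eq_zero key)

theorem vev_sub (A B : Module.End R (Fock R)) : vev (A - B) = vev A - vev B := rfl

theorem vev_one : vev (1 : Module.End R (Fock R)) = 1 := by
  simp [vev]

theorem vev_weightedE (w : ℤ → R) (n : ℤ) : vev (weightedE w n) = 0 := by
  rcases le_total n 0 with h | h
  · exact weightedE_apply_vacuum w h _
  · exact (congrArg (fun v : Fock R => v Maya.vacuum) (weightedE_vacuum w h))

theorem vev_psi_psiDagger (i j : ℤ) :
    psi R i (psiDagger R j (ket R Maya.vacuum)) Maya.vacuum = if i = j ∧ j < 0 then 1 else 0 := by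
  by_cases hi : i < 0
  · have h := LinearMap.congr_fun (psiDagger_mul_psi (R := R) j i) (ket R Maya.vacuum)
    have h1 : psi R i (ket R Maya.vacuum) = 0 := psi_ket_mem (Maya.mem_vacuum.2 hi)
    have h2 : (if j = i then (1 : Module.End R (Fock R)) else 0) (ket R Maya.vacuum) -
        psi R i (psiDagger R j (ket R Maya.vacuum)) = 0 := by
      refine Eq.trans h.symm ?_
      rw [Module.End.mul_apply, h1, map_zero]
    rw [← sub_eq_zero.1 h2]
    by_cases hij : j = i
    · subst hij; simp [ket, hi]
    · simp [hij, Ne.symm hij]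
  · rw [psi_apply_notMem (by rw [Maya.mem_vacuum]; exact hi), if_neg (by omega)]

/-- The central term of the commutator: for `a + b = 0`, the second factor lifts a particle from
`i - a < 0` to `i ≥ 0`, and the first one moves it back. -/
theorem vev_weightedE_mul (w v : ℤ → R) {a : ℤ} (b : ℤ) (ha : 0 ≤ a) :
    vev (weightedE w a * weightedE v b) =
      if a + b = 0 then ∑ i ∈ Finset.range a.toNat, w i * v (i - a) else 0 := by
  set Ω := ket R Maya.vacuum with hΩ
  have hW : weightedE w a Ω = 0 := weightedE_vacuum w ha
  -- `W` is commuted through `ψ_{j-b} ψ_j†` until it meets the vacuum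
  have key : ∀ j, weightedE w a (normalE R (j - b) j Ω) Maya.vacuum =
      if a + b = 0 ∧ -a ≤ j ∧ j < 0 then w (j + a) else 0 := by
    intro j
    have h1 : weightedE w a (normalE R (j - b) j Ω) =
        weightedE w a (psi R (j - b) (psiDagger R j Ω)) := by
      rw [normalE_eq]
      have : (psi R (j - b) * psiDagger R j - if j - b = j ∧ j < 0 then 1 else 0) Ω =
          psi R (j - b) (psiDagger R j Ω) - (if j - b = j ∧ j < 0 then (1 : R) else 0) • Ω := by
        split_ifs <;> simp
      rw [this, map_sub, map_smul, hW, smul_zero, sub_zero]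
    rw [h1, weightedE_psi_apply, weightedE_psiDagger_apply, hW, map_zero, zero_sub, map_neg,
      map_smul, Finsupp.add_apply, Finsupp.neg_apply, Finsupp.smul_apply, Finsupp.smul_apply,
      vev_psi_psiDagger, vev_psi_psiDagger]
    by_cases hab : a + b = 0
    · obtain rfl : b = -a := by omega
      simp only [sub_neg_eq_add, add_sub_cancel_right, true_and, add_neg_cancel]
      by_cases h2 : j < 0 <;> by_cases h3 : j + a < 0
      · simp [h2, h3, show ¬ -a ≤ j by omega]
      · simp [h2, h3, show -a ≤ j by omega]
      · omega
      · simp [h2, h3]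
    · rw [if_neg (by omega), if_neg (by omega), if_neg (by omega)]; simp
  have h2 : vev (weightedE w a * weightedE v b) =
      ∑ᶠ j : ℤ, v j * weightedE w a (normalE R (j - b) j Ω) Maya.vacuum := by
    have h := ((Finsupp.applyAddHom (M := R) Maya.vacuum).comp
      (weightedE w a).toAddMonoidHom).map_finsum (weightedE_support_finite v b Ω)
    rw [← weightedE_apply] at h
    refine Eq.trans h (finsum_congr fun j => ?_)
    change weightedE w a (v j • normalE R (j - b) j Ω) Maya.vacuum = _
    rw [map_smul]; rfl
  rw [h2]
  simp only [key]
  split_ifs with hab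
  · simp only [hab, true_and]
    lift a to ℕ using ha
    rw [finsum_eq_sum_of_support_subset (s := (Finset.range a).image fun i : ℕ => (i : ℤ) - a)]
    · rw [Finset.sum_image (by intro x _ y _ h; simpa using h)]
      simp only [Int.toNat_natCast]
      refine Finset.sum_congr rfl fun i hi => ?_
      rw [Finset.mem_range] at hi
      rw [if_pos (by omega), mul_comm]
      congr 2; omega
    · intro j hj
      rw [Function.mem_support] at hj
      have : -(a : ℤ) ≤ j ∧ j < 0 := by
        by_contra h; exact hj (by rw [if_neg h, mul_zero])
      simp only [Finset.coe_image, Set.mem_image, Finset.mem_coe, Finset.mem_range]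
      exact ⟨(j + a).toNat, by omega, by omega⟩
  · simp [hab]

/-- The commutation relation of the operators `∑_j w(j) E_{j-a,j}`, including its central term.
Both sides have the same commutators with all fermions, so they differ by a scalar, which is found
by taking vacuum expectation values. -/
theorem weightedE_mul_weightedE (w v : ℤ → R) {a : ℤ} (b : ℤ) (ha : 0 ≤ a) :
    weightedE w a * weightedE v b = weightedE v b * weightedE w a +
      weightedE (fun j => w (j - b) * v j - v (j - a) * w j) (a + b) +
      (if a + b = 0 then ∑ i ∈ Finset.range a.toNat, w i * v (i - a) else 0) • 1 := by
  set W := weightedE w a with hW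
  set V := weightedE v b with hV
  set Z := weightedE (fun j => w (j - b) * v j - v (j - a) * w j) (a + b) with hZ
  set D : Module.End R (Fock R) := W * V - V * W - Z with hD
  have hDv : ∀ u, D u = W (V u) - V (W u) - Z u := fun u => rfl
  -- the double commutators agree by the Jacobi identity
  have h1 : ∀ k, D * psi R k = psi R k * D := by
    intro k
    refine LinearMap.ext fun u => ?_
    change D (psi R k u) = psi R k (D u)
    rw [hDv, hDv, hW, hV, hZ]
    simp only [weightedE_psi_apply, map_add, map_sub, map_smul]
    rw [show k - (a + b) = k - b - a by ring, show k - a - b = k - b - a by ring]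
    module
  have h2 : ∀ k, D * psiDagger R k = psiDagger R k * D := by
    intro k
    refine LinearMap.ext fun u => ?_
    change D (psiDagger R k u) = psiDagger R k (D u)
    rw [hDv, hDv, hW, hV, hZ]
    simp only [weightedE_psiDagger_apply, map_sub, map_smul]
    rw [show k + (a + b) = k + a + b by ring, show k + b + a = k + a + b by ring,
      show k + a + b - b = k + a by ring, show k + a + b - a = k + b by ring]
    module
  have h3 := eq_vev_smul_one_of_commute h1 h2
  have h4 : vev D = vev (W * V) := by
    have h5 : vev (V * W) = 0 := by
      have h6 : W (ket R Maya.vacuum) = 0 := weightedE_vacuum w ha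
      change V (W (ket R Maya.vacuum)) Maya.vacuum = 0
      rw [h6, map_zero]; rfl
    rw [hD, vev_sub, vev_sub, h5, hZ, vev_weightedE, sub_zero, sub_zero]
  rw [h4, hW, hV, vev_weightedE_mul w v b ha] at h3
  refine LinearMap.ext fun u => ?_
  have h7 := LinearMap.congr_fun h3 u
  rw [hDv, LinearMap.smul_apply] at h7
  rw [LinearMap.add_apply, LinearMap.add_apply, LinearMap.smul_apply, ← h7]
  change W (V u) = V (W u) + Z u + (W (V u) - V (W u) - Z u)
  abel

end Fock

/-! ### Families of power series with coefficients in an algebra of functions -/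

section Series

variable {σ X : Type*} (𝒜 : Subalgebra ℚ (X → ℚ))

/-- A family of power series over `ℚ`, indexed by `X`, all of whose coefficients are functions in
`𝒜`. -/
def CoeffIn (f : X → MvPowerSeries σ ℚ) : Prop :=
  ∀ d : σ →₀ ℕ, (fun x => MvPowerSeries.coeff d (f x)) ∈ 𝒜

variable {𝒜}

theorem CoeffIn.zero : CoeffIn 𝒜 (fun _ => (0 : MvPowerSeries σ ℚ)) := fun d =>
  𝒜.algebraMap_mem (MvPowerSeries.coeff d (0 : MvPowerSeries σ ℚ))

theorem CoeffIn.one : CoeffIn 𝒜 (fun _ => (1 : MvPowerSeries σ ℚ)) := fun d =>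
  𝒜.algebraMap_mem (MvPowerSeries.coeff d (1 : MvPowerSeries σ ℚ))

theorem CoeffIn.add {f g : X → MvPowerSeries σ ℚ} (hf : CoeffIn 𝒜 f) (hg : CoeffIn 𝒜 g) :
    CoeffIn 𝒜 (fun x => f x + g x) := fun d =>
  𝒜.add_mem (hf d) (hg d)

theorem CoeffIn.sub {f g : X → MvPowerSeries σ ℚ} (hf : CoeffIn 𝒜 f) (hg : CoeffIn 𝒜 g) :
    CoeffIn 𝒜 (fun x => f x - g x) := fun d =>
  𝒜.sub_mem (hf d) (hg d)

theorem CoeffIn.mul {f g : X → MvPowerSeries σ ℚ} (hf : CoeffIn 𝒜 f) (hg : CoeffIn 𝒜 g) :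
    CoeffIn 𝒜 (fun x => f x * g x) := fun d => by
  classical
  have h : (fun x => MvPowerSeries.coeff d (f x * g x)) = ∑ p ∈ Finset.HasAntidiagonal.antidiagonal d,
      (fun x => MvPowerSeries.coeff p.1 (f x)) * (fun x => MvPowerSeries.coeff p.2 (g x)) := by
    ext x
    simp [MvPowerSeries.coeff_mul]
  change (fun x => MvPowerSeries.coeff d (f x * g x)) ∈ 𝒜
  rw [h]
  exact 𝒜.sum_mem fun p _ => 𝒜.mul_mem (hf _) (hg _)

theorem CoeffIn.smul {c : X → ℚ} (hc : c ∈ 𝒜) {f : X → MvPowerSeries σ ℚ} (hf : CoeffIn 𝒜 f) :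
    CoeffIn 𝒜 (fun x => c x • f x) := fun d =>
  𝒜.mul_mem hc (hf d)

theorem CoeffIn.prod {ι : Type*} (P : Finset ι) {f : ι → X → MvPowerSeries σ ℚ}
    (hf : ∀ i ∈ P, CoeffIn 𝒜 (f i)) : CoeffIn 𝒜 (fun x => ∏ i ∈ P, f i x) := by
  classical
  induction P using Finset.induction_on with
  | empty => simpa using CoeffIn.one
  | insert a s ha ih =>
    simp only [Finset.prod_insert ha]
    exact (hf a (Finset.mem_insert_self _ _)).mul
      (ih fun i hi => hf i (Finset.mem_insert_of_mem hi))

/-- The power series with given coefficients. -/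
def ofCoeff (c : (σ →₀ ℕ) → ℚ) : MvPowerSeries σ ℚ := c

theorem coeff_ofCoeff (c : (σ →₀ ℕ) → ℚ) (d : σ →₀ ℕ) :
    MvPowerSeries.coeff d (ofCoeff c) = c d := rfl

variable {s : ℕ}

theorem coeff_expVar (p : Fin s) (c : ℚ) (d : Fin s →₀ ℕ) :
    MvPowerSeries.coeff d (expVar p c) =
      if d = Finsupp.single p (d p) then c ^ d p / (d p).factorial else 0 := by
  rw [expVar, PowerSeries.coeff_subst_single]
  simp [PowerSeries.coeff_rescale, PowerSeries.coeff_exp, div_eq_mul_inv]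

theorem expVar_add (p : Fin s) (a b : ℚ) : expVar p (a + b) = expVar p a * expVar p b := by
  rw [expVar, ← PowerSeries.exp_mul_exp_eq_exp_add, PowerSeries.subst_mul (PowerSeries.HasSubst.X p)]
  rfl

theorem CoeffIn.expVar (p : Fin s) {c : X → ℚ} (hc : c ∈ 𝒜) :
    CoeffIn 𝒜 (fun x => expVar p (c x)) := fun d => by
  simp only [coeff_expVar]
  split_ifs
  · simp only [div_eq_inv_mul]
    exact 𝒜.smul_mem (𝒜.pow_mem hc _) _
  · exact 𝒜.zero_mem

/-- `exp (c ∑_{p ∈ P} z_p)`. -/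
def expSum (P : Finset (Fin s)) (c : ℚ) : MvPowerSeries (Fin s) ℚ := ∏ p ∈ P, expVar p c

theorem expSum_add (P : Finset (Fin s)) (a b : ℚ) :
    expSum P (a + b) = expSum P a * expSum P b := by
  simp [expSum, expVar_add, Finset.prod_mul_distrib]

theorem expSum_empty (c : ℚ) : expSum (∅ : Finset (Fin s)) c = 1 := by
  simp [expSum]

theorem expSum_union {P Q : Finset (Fin s)} (h : Disjoint P Q) (c : ℚ) :
    expSum (P ∪ Q) c = expSum P c * expSum Q c := by
  simp [expSum, Finset.prod_union h]

theorem CoeffIn.expSum (P : Finset (Fin s)) {c : X → ℚ} (hc : c ∈ 𝒜) :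
    CoeffIn 𝒜 (fun x => expSum P (c x)) :=
  CoeffIn.prod P fun p _ => CoeffIn.expVar p hc

theorem exists_expVar_sub_one (p : Fin s) {c : X → ℚ} (hc : c ∈ 𝒜) :
    ∃ g, CoeffIn 𝒜 g ∧ ∀ x, LeakyHurwitz.expVar p (c x) - 1 = c x • g x := by
  refine ⟨fun x => ofCoeff fun d => if d = Finsupp.single p (d p) ∧ d p ≠ 0
    then c x ^ (d p - 1) / (d p).factorial else 0, fun d => ?_, fun x => ?_⟩
  · change (fun x => if d = Finsupp.single p (d p) ∧ d p ≠ 0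
      then c x ^ (d p - 1) / (d p).factorial else 0) ∈ 𝒜
    split_ifs
    · simp only [div_eq_inv_mul]
      exact 𝒜.smul_mem (𝒜.pow_mem hc _) _
    · exact 𝒜.zero_mem
  · ext d
    rw [map_sub, coeff_expVar, MvPowerSeries.coeff_one, MvPowerSeries.coeff_smul, coeff_ofCoeff]
    by_cases h0 : d p = 0
    · by_cases hd : d = 0
      · subst hd; simp
      · have : d ≠ Finsupp.single p (d p) := by rw [h0, Finsupp.single_zero]; exact hd
        rw [if_neg this, if_neg hd, if_neg (fun h => this h.1)]; simp
    · have hd : d ≠ 0 := by rintro rfl; exact h0 rfl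
      rw [if_neg hd, sub_zero]
      by_cases h1 : d = Finsupp.single p (d p)
      · rw [if_pos h1, if_pos ⟨h1, h0⟩, ← mul_div_assoc, ← pow_succ', Nat.sub_add_cancel (by omega)]
      · rw [if_neg h1, if_neg (fun h => h1 h.1), mul_zero]

/-- `exp (c z) - 1` is divisible by `c`, with a quotient whose coefficients are again in `𝒜`. -/
theorem exists_expSum_sub_one (P : Finset (Fin s)) {c : X → ℚ} (hc : c ∈ 𝒜) :
    ∃ g, CoeffIn 𝒜 g ∧ ∀ x, LeakyHurwitz.expSum P (c x) - 1 = c x • g x := by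
  classical
  induction P using Finset.induction_on with
  | empty => exact ⟨_, CoeffIn.zero, fun x => by simp [expSum_empty]⟩
  | insert a P ha ih =>
    obtain ⟨g, hg, hgx⟩ := ih
    obtain ⟨h, hh, hhx⟩ := exists_expVar_sub_one a hc
    refine ⟨_, (hh.mul (CoeffIn.expSum P hc)).add hg, fun x => ?_⟩
    have h1 : LeakyHurwitz.expSum (Insert.insert a P) (c x) =
        LeakyHurwitz.expVar a (c x) * LeakyHurwitz.expSum P (c x) := by
      simp [LeakyHurwitz.expSum, Finset.prod_insert ha]
    rw [smul_add, ← hgx, ← smul_mul_assoc, ← hhx, h1]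
    ring

/-- `ς (c z) = exp (c z / 2) - exp (-c z / 2)` is divisible by `c`. -/
theorem exists_expSum_sub (P : Finset (Fin s)) {c : X → ℚ} (hc : c ∈ 𝒜) :
    ∃ g, CoeffIn 𝒜 g ∧
      ∀ x, LeakyHurwitz.expSum P (c x / 2) - LeakyHurwitz.expSum P (-c x / 2) = c x • g x := by
  have hc1 : (fun x => c x / 2) ∈ 𝒜 := by
    simp only [div_eq_inv_mul]; exact 𝒜.smul_mem hc _
  have hc2 : (fun x => -c x / 2) ∈ 𝒜 := by
    simp only [div_eq_inv_mul]; exact 𝒜.smul_mem (𝒜.neg_mem hc) _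
  obtain ⟨g, hg, hgx⟩ := exists_expSum_sub_one P hc1
  obtain ⟨h, hh, hhx⟩ := exists_expSum_sub_one P hc2
  have h12 : (fun _ : X => (1 / 2 : ℚ)) ∈ 𝒜 := 𝒜.algebraMap_mem (1 / 2)
  refine ⟨_, CoeffIn.smul h12 (hg.add hh), fun x => ?_⟩
  have : LeakyHurwitz.expSum P (c x / 2) - LeakyHurwitz.expSum P (-c x / 2) =
    (LeakyHurwitz.expSum P (c x / 2) - 1) - (LeakyHurwitz.expSum P (-c x / 2) - 1) := by ring
  rw [this, hgx, hhx]
  module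

/-! ### Sums over an interval -/

/-- Faulhaber's formula; every exponent in it is positive, so the sum is divisible by `a`. -/
theorem exists_sum_range_pow (i : ℕ) : ∃ p : Polynomial ℚ, ∀ a : ℕ,
    ∑ j ∈ Finset.range a, (j : ℚ) ^ i = a * p.eval (a : ℚ) := by
  refine ⟨∑ l ∈ Finset.range (i + 1), Polynomial.C (bernoulli l * ((i + 1).choose l) / (i + 1)) *
    Polynomial.X ^ (i - l), fun a => ?_⟩
  rw [sum_range_pow, Polynomial.eval_finsetSum, Finset.mul_sum]
  refine Finset.sum_congr rfl fun l hl => ?_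
  rw [Finset.mem_range] at hl
  rw [show i + 1 - l = i - l + 1 by omega, pow_succ]
  simp only [Polynomial.eval_mul, Polynomial.eval_C, Polynomial.eval_pow, Polynomial.eval_X]
  ring

theorem exists_sum_range_eval (q : Polynomial ℚ) : ∃ p : Polynomial ℚ, ∀ a : ℕ,
    ∑ j ∈ Finset.range a, q.eval ((j : ℚ) + 1 / 2 - a / 2) = a * p.eval (a : ℚ) := by
  induction q using Polynomial.induction_on' with
  | add q₁ q₂ h₁ h₂ =>
    obtain ⟨p₁, h₁⟩ := h₁
    obtain ⟨p₂, h₂⟩ := h₂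
    refine ⟨p₁ + p₂, fun a => ?_⟩
    simp only [Polynomial.eval_add, Finset.sum_add_distrib, h₁, h₂, mul_add]
  | monomial n c =>
    choose p hp using exists_sum_range_pow
    refine ⟨∑ i ∈ Finset.range (n + 1), Polynomial.C (c * n.choose i) * p i *
      (Polynomial.C (1 / 2) - Polynomial.C (1 / 2) * Polynomial.X) ^ (n - i), fun a => ?_⟩
    have : ∀ j : ℕ, (Polynomial.monomial n c).eval ((j : ℚ) + 1 / 2 - a / 2) =
        ∑ i ∈ Finset.range (n + 1), (j : ℚ) ^ i * (c * n.choose i * (1 / 2 - 1 / 2 * a) ^ (n - i)) := by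
      intro j
      rw [Polynomial.eval_monomial, show (j : ℚ) + 1 / 2 - a / 2 = j + (1 / 2 - 1 / 2 * a) by ring,
        add_pow, Finset.mul_sum]
      refine Finset.sum_congr rfl fun i _ => by ring
    simp only [this]
    rw [Finset.sum_comm, Polynomial.eval_finsetSum, Finset.mul_sum]
    refine Finset.sum_congr rfl fun i _ => ?_
    rw [← Finset.sum_mul, hp]
    simp only [Polynomial.eval_mul, Polynomial.eval_C, Polynomial.eval_pow, Polynomial.eval_X,
      Polynomial.eval_sub]
    ring

/-- The functions on `ℚ` given by polynomials. -/
def polyFunctions : Subalgebra ℚ (ℚ → ℚ) :=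
  (AlgHom.pi fun c : ℚ => Polynomial.aeval (R := ℚ) c).range

/-- The central terms `∑_{0 ≤ j < a} exp (z (j + 1/2 - a/2))`, which sum up to
`ς (a z) / ς (z)`, have coefficients polynomial in `a`, and are divisible by `a`. -/
theorem exists_sum_expSum (P : Finset (Fin s)) {e : X → ℤ} (he : (fun x => (e x : ℚ)) ∈ 𝒜)
    (h0 : ∀ x, 0 ≤ e x) : ∃ g, CoeffIn 𝒜 g ∧ ∀ x, ∑ j ∈ Finset.range (e x).toNat,
      LeakyHurwitz.expSum P ((j : ℚ) + 1 / 2 - e x / 2) = (e x : ℚ) • g x := by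
  have hid : (fun c : ℚ => c) ∈ polyFunctions := ⟨Polynomial.X, by ext c; simp⟩
  -- coefficientwise, `exp (c z)` is a polynomial in `c`
  have h1 : ∀ d : Fin s →₀ ℕ, ∃ q : Polynomial ℚ,
      ∀ c : ℚ, MvPowerSeries.coeff d (LeakyHurwitz.expSum P c) = q.eval c := by
    intro d
    obtain ⟨q, hq⟩ := CoeffIn.expSum P hid d
    exact ⟨q, fun c => by simpa [Polynomial.aeval_def] using (congrFun hq c).symm⟩
  choose q hq using h1
  choose p hp using fun d => exists_sum_range_eval (q d)
  refine ⟨fun x => ofCoeff fun d => (p d).eval (e x : ℚ), fun d => ?_, fun x => ?_⟩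
  · change (fun x => (p d).eval (e x : ℚ)) ∈ 𝒜
    have : (fun x => (p d).eval (e x : ℚ)) = Polynomial.aeval (fun x => (e x : ℚ)) (p d) := by
      ext x
      rw [Polynomial.eval_eq_sum_range, Polynomial.aeval_eq_sum_range]
      simp
    rw [this, Polynomial.aeval_eq_sum_range]
    exact 𝒜.sum_mem fun i _ => 𝒜.smul_mem (𝒜.pow_mem he _) _
  · ext d
    rw [map_sum, MvPowerSeries.coeff_smul, coeff_ofCoeff]
    simp only [hq]
    obtain ⟨a, ha⟩ := Int.eq_ofNat_of_zero_le (h0 x)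
    rw [ha]
    simpa using hp d a

end Series

/-! ### Block operators -/

section Blocks

variable {s : ℕ}

/-- The operator `𝓔_e(z)` for `z = ∑_{p ∈ P} z_p`, without its constant term. -/
def blockOp (e : ℤ) (P : Finset (Fin s)) :
    Module.End (MvPowerSeries (Fin s) ℚ) (Fock (MvPowerSeries (Fin s) ℚ)) :=
  weightedE (fun j => expSum P ((j : ℚ) + 1 / 2 - e / 2)) e

theorem weightedE_mul_left {R : Type*} [CommRing R] (c : R) (w : ℤ → R) (n : ℤ) (v : Fock R) :
    weightedE (fun j => c * w j) n v = c • weightedE w n v := by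
  rw [weightedE_apply, weightedE_apply, smul_finsum' c (weightedE_support_finite w n v)]
  simp only [mul_smul]

/-- The factor `ς (a z_Q - b z_P)` in the commutator of `𝓔_a(z_P)` and `𝓔_b(z_Q)`. -/
def commFactor (a b : ℤ) (P Q : Finset (Fin s)) : MvPowerSeries (Fin s) ℚ :=
  expSum P (-b / 2) * expSum Q (a / 2) - expSum P (b / 2) * expSum Q (-a / 2)

/-- The central term in the commutator of `𝓔_a(z_P)` and `𝓔_b(z_Q)`, for `P ∪ Q = U`. -/
def commConst (a b : ℤ) (U : Finset (Fin s)) : MvPowerSeries (Fin s) ℚ :=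
  if a + b = 0 then ∑ j ∈ Finset.range a.toNat, expSum U ((j : ℚ) + 1 / 2 - a / 2) else 0

theorem blockOp_comm_apply {a : ℤ} (b : ℤ) (ha : 0 ≤ a) {P Q : Finset (Fin s)}
    (hPQ : Disjoint P Q) (u : Fock (MvPowerSeries (Fin s) ℚ)) :
    blockOp a P (blockOp b Q u) = blockOp b Q (blockOp a P u) +
      commFactor a b P Q • blockOp (a + b) (P ∪ Q) u + commConst a b (P ∪ Q) • u := by
  have h := LinearMap.congr_fun (weightedE_mul_weightedE
    (fun j => expSum P ((j : ℚ) + 1 / 2 - a / 2)) (fun j => expSum Q ((j : ℚ) + 1 / 2 - b / 2))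
    b ha) u
  refine Eq.trans h ?_
  have h1 : (fun j : ℤ => expSum P (((j - b : ℤ) : ℚ) + 1 / 2 - a / 2) *
      expSum Q ((j : ℚ) + 1 / 2 - b / 2) - expSum Q (((j - a : ℤ) : ℚ) + 1 / 2 - b / 2) *
      expSum P ((j : ℚ) + 1 / 2 - a / 2)) = fun j : ℤ => commFactor a b P Q *
        expSum (P ∪ Q) ((j : ℚ) + 1 / 2 - (a + b : ℤ) / 2) := by
    ext1 j
    rw [expSum_union hPQ, commFactor]
    set c : ℚ := (j : ℚ) + 1 / 2 - (a + b : ℤ) / 2 with hc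
    have e1 : ((j - b : ℤ) : ℚ) + 1 / 2 - a / 2 = -b / 2 + c := by rw [hc]; push_cast; ring
    have e2 : (j : ℚ) + 1 / 2 - b / 2 = a / 2 + c := by rw [hc]; push_cast; ring
    have e3 : ((j - a : ℤ) : ℚ) + 1 / 2 - b / 2 = -a / 2 + c := by rw [hc]; push_cast; ring
    have e4 : (j : ℚ) + 1 / 2 - a / 2 = b / 2 + c := by rw [hc]; push_cast; ring
    rw [e1, e2, e3, e4, expSum_add, expSum_add, expSum_add, expSum_add]
    ring
  have h2 : (if a + b = 0 then ∑ i ∈ Finset.range a.toNat,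
      expSum P (((i : ℤ) : ℚ) + 1 / 2 - a / 2) *
        expSum Q ((((i : ℤ) - a : ℤ) : ℚ) + 1 / 2 - b / 2) else 0) = commConst a b (P ∪ Q) := by
    unfold commConst
    split_ifs with hab
    · obtain rfl : b = -a := by omega
      refine Finset.sum_congr rfl fun i _ => ?_
      rw [expSum_union hPQ]
      congr 2
      push_cast; ring
    · rfl
  simp only [LinearMap.add_apply, LinearMap.smul_apply, Module.End.one_apply,
    Module.End.mul_apply]
  rw [h1, h2, weightedE_mul_left]
  rfl

end Blocks

/-! ### The commutation algorithm -/

section Algorithm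

variable {Γ : Type*} {s : ℕ} {X : Type*}

/-- The energy of a block of operators. -/
def energy (ε : Γ ⊕ Fin s → ℤ) (B : Finset (Γ ⊕ Fin s)) : ℤ := ∑ i ∈ B, ε i

/-- The vacuum expectation value of a product of block operators. The elements `inl i` of a block
stand for the operators `α`, and `inr p` for the operator which carries the variable `z_p`. -/
def corr (ε : Γ ⊕ Fin s → ℤ) (L : List (Finset (Γ ⊕ Fin s))) : MvPowerSeries (Fin s) ℚ :=
  vev (L.map fun B => blockOp (energy ε B) B.toRight).prod

/-- The factor which a block contributes to the vacuum expectation value: the energy for a block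
which consists of a single operator `α`, and `1` for all other blocks. -/
def blockFactor (ε : Γ ⊕ Fin s → ℤ) (B : Finset (Γ ⊕ Fin s)) : ℚ :=
  if B.card = 1 ∧ B.toRight = ∅ then (energy ε B : ℚ) else 1

/-- Operators of nonpositive energy kill the covacuum. -/
theorem corr_eq_zero_of_head {ε : Γ ⊕ Fin s → ℤ} {B : Finset (Γ ⊕ Fin s)}
    (hB : energy ε B ≤ 0) (L : List (Finset (Γ ⊕ Fin s))) : corr ε (B :: L) = 0 := by
  rw [corr, List.map_cons, List.prod_cons]
  exact weightedE_apply_vacuum _ hB _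

/-- Operators of nonnegative energy kill the vacuum. -/
theorem corr_eq_zero_of_last {ε : Γ ⊕ Fin s → ℤ} {B : Finset (Γ ⊕ Fin s)}
    (hB : 0 ≤ energy ε B) (L : List (Finset (Γ ⊕ Fin s))) : corr ε (L ++ [B]) = 0 := by
  rw [corr, List.map_append, List.prod_append, List.map_singleton, List.prod_singleton]
  have h : blockOp (energy ε B) B.toRight (ket _ Maya.vacuum) = 0 := weightedE_vacuum _ hB
  refine Eq.trans (congrArg (fun v : Fock (MvPowerSeries (Fin s) ℚ) => (List.map (fun B =>
    blockOp (energy ε B) B.toRight) L).prod v Maya.vacuum) h) ?_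
  rw [map_zero]; rfl

theorem disjoint_toRight {B c : Finset (Γ ⊕ Fin s)} (h : Disjoint B c) :
    Disjoint B.toRight c.toRight := by
  rw [Finset.disjoint_left] at h ⊢
  intro p hp hq
  exact h (Finset.mem_toRight.1 hp) (Finset.mem_toRight.1 hq)

section Coefficients

variable {𝒜 : Subalgebra ℚ (X → ℚ)} {ε : X → Γ ⊕ Fin s → ℤ}

theorem energy_mem (hε : ∀ i, (fun x => (ε x i : ℚ)) ∈ 𝒜) (B : Finset (Γ ⊕ Fin s)) :
    (fun x => (energy (ε x) B : ℚ)) ∈ 𝒜 := by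
  have : (fun x => (energy (ε x) B : ℚ)) = ∑ i ∈ B, fun x => (ε x i : ℚ) := by
    ext x; simp [energy]
  rw [this]
  exact 𝒜.sum_mem fun i _ => hε i

theorem half_mem {c : X → ℚ} (hc : c ∈ 𝒜) : (fun x => c x / 2) ∈ 𝒜 := by
  simp only [div_eq_inv_mul]; exact 𝒜.smul_mem hc _

/-- A commutator with `α_μ` contributes a factor divisible by `μ`. -/
theorem exists_commFactor (hε : ∀ i, (fun x => (ε x i : ℚ)) ∈ 𝒜) (B c : Finset (Γ ⊕ Fin s)) :
    ∃ g, CoeffIn 𝒜 g ∧ ∀ x, commFactor (energy (ε x) B) (energy (ε x) c) B.toRight c.toRight =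
      (blockFactor (ε x) B * blockFactor (ε x) c) • g x := by
  have hB := energy_mem hε B
  have hc := energy_mem hε c
  by_cases h1 : B.card = 1 ∧ B.toRight = ∅ <;> by_cases h2 : c.card = 1 ∧ c.toRight = ∅
  · refine ⟨_, CoeffIn.zero, fun x => ?_⟩
    simp [commFactor, h1.2, h2.2, expSum_empty]
  · obtain ⟨g, hg, hgx⟩ := exists_expSum_sub c.toRight hB
    refine ⟨g, hg, fun x => ?_⟩
    rw [blockFactor, if_pos h1, blockFactor, if_neg h2, mul_one, ← hgx]
    simp [commFactor, h1.2, expSum_empty]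
  · obtain ⟨g, hg, hgx⟩ := exists_expSum_sub B.toRight hc
    refine ⟨_, CoeffIn.zero.sub hg, fun x => ?_⟩
    rw [blockFactor, if_neg h1, blockFactor, if_pos h2, one_mul, zero_sub, smul_neg, ← hgx]
    simp [commFactor, h2.2, expSum_empty]
  · refine ⟨_, ((CoeffIn.expSum B.toRight (half_mem (𝒜.neg_mem hc))).mul
      (CoeffIn.expSum c.toRight (half_mem hB))).sub
      ((CoeffIn.expSum B.toRight (half_mem hc)).mul
      (CoeffIn.expSum c.toRight (half_mem (𝒜.neg_mem hB)))), fun x => ?_⟩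
    rw [blockFactor, if_neg h1, blockFactor, if_neg h2, one_mul, one_smul]
    rfl

end Coefficients

variable [DecidableEq Γ]

/-- The list `L` consists of the blocks of a set partition of `Γ ⊕ Fin s`. -/
def IsPartitionList (L : List (Finset (Γ ⊕ Fin s))) : Prop :=
  (∀ B ∈ L, B.Nonempty) ∧ ∀ t, L.countP (fun B => t ∈ B) = 1

theorem energy_union {ε : Γ ⊕ Fin s → ℤ} {B c : Finset (Γ ⊕ Fin s)} (h : Disjoint B c) :
    energy ε (B ∪ c) = energy ε B + energy ε c := Finset.sum_union h

/-- One step of the algorithm: two adjacent operators are exchanged. -/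
theorem corr_exchange {ε : Γ ⊕ Fin s → ℤ} {B c : Finset (Γ ⊕ Fin s)} (hBc : Disjoint B c)
    (hB : 0 ≤ energy ε B) (A C : List (Finset (Γ ⊕ Fin s))) :
    corr ε (A ++ B :: c :: C) = corr ε (A ++ c :: B :: C) +
      commFactor (energy ε B) (energy ε c) B.toRight c.toRight * corr ε (A ++ (B ∪ c) :: C) +
      commConst (energy ε B) (energy ε c) (B ∪ c).toRight * corr ε (A ++ C) := by
  have h := blockOp_comm_apply (energy ε c) hB (disjoint_toRight hBc)
    ((C.map fun B => blockOp (energy ε B) B.toRight).prod (ket _ Maya.vacuum))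
  simp only [corr, List.map_append, List.prod_append, List.map_cons, List.prod_cons]
  rw [Finset.toRight_union, energy_union hBc]
  exact congrArg (fun v : Fock (MvPowerSeries (Fin s) ℚ) => (List.map (fun B =>
    blockOp (energy ε B) B.toRight) A).prod v Maya.vacuum) h |>.trans (by
      simp only [map_add, map_smul]; rfl)

section Partition

variable {A C : List (Finset (Γ ⊕ Fin s))} {B c : Finset (Γ ⊕ Fin s)}

theorem IsPartitionList.disjoint (h : IsPartitionList (A ++ B :: c :: C)) : Disjoint B c := by
  rw [Finset.disjoint_left]
  intro t hB hc
  have := h.2 t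
  simp [List.countP_append, hB, hc] at this
  omega

theorem IsPartitionList.swap (h : IsPartitionList (A ++ B :: c :: C)) :
    IsPartitionList ((A ++ [c]) ++ B :: C) := by
  refine ⟨fun D hD => h.1 D ?_, fun t => ?_⟩
  · simp only [List.mem_append, List.mem_cons, List.not_mem_nil, or_false] at hD ⊢
    tauto
  · have := h.2 t
    simp only [List.countP_append, List.countP_cons, List.countP_nil] at this ⊢
    omega

theorem IsPartitionList.merge (h : IsPartitionList (A ++ B :: c :: C)) :
    IsPartitionList (A ++ (B ∪ c) :: C) := by
  refine ⟨fun D hD => ?_, fun t => ?_⟩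
  · simp only [List.mem_append, List.mem_cons] at hD
    rcases hD with hD | rfl | hD
    · exact h.1 D (by simp [hD])
    · exact (h.1 B (by simp)).mono Finset.subset_union_left
    · exact h.1 D (by simp [hD])
  · have := h.2 t
    have hd : t ∈ B → t ∉ c := fun h1 => Finset.disjoint_left.1 h.disjoint h1
    simp only [List.countP_append, List.countP_cons, Finset.mem_union] at this ⊢
    by_cases h1 : t ∈ B <;> by_cases h2 : t ∈ c
    · exact absurd h2 (hd h1)
    all_goals simp [h1, h2] at this ⊢; omega

theorem IsPartitionList.disjoint_of_mem (h : IsPartitionList (A ++ B :: c :: C))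
    {D : Finset (Γ ⊕ Fin s)} (hD : D ∈ A ++ C) : Disjoint D (B ∪ c) := by
  rw [Finset.disjoint_left]
  intro t ht hBc
  have h1 := h.merge.2 t
  have h2 : 0 < (A ++ C).countP (fun B => t ∈ B) := List.countP_pos_iff.2 ⟨D, hD, by simpa⟩
  simp only [List.countP_append, List.countP_cons, hBc, decide_true, if_true] at h1 h2
  omega

variable [Fintype Γ]

theorem IsPartitionList.eq_nil (h : IsPartitionList (A ++ B :: c :: C))
    (hBc : B ∪ c = Finset.univ) : A ++ C = [] := by
  refine List.eq_nil_iff_forall_not_mem.2 fun D hD => ?_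
  have h1 := h.disjoint_of_mem hD
  obtain ⟨t, ht⟩ := h.1 D (by
    simp only [List.mem_append, List.mem_cons] at hD ⊢; tauto)
  exact Finset.disjoint_left.1 h1 ht (by rw [hBc]; exact Finset.mem_univ t)

theorem IsPartitionList.ne_nil (h : IsPartitionList (A ++ B :: c :: C))
    (hBc : B ∪ c ≠ Finset.univ) : A ++ C ≠ [] := by
  intro h0
  apply hBc
  ext t
  have := h.merge.2 t
  rw [List.append_eq_nil_iff] at h0
  simp only [h0.1, h0.2, List.nil_append, List.countP_cons, List.countP_nil] at this
  by_contra h'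
  simp only [Finset.mem_univ, iff_true] at h'
  simp [h'] at this

end Partition

/-- A block which results from a merge is not a single operator. -/
theorem blockFactor_union (ε : Γ ⊕ Fin s → ℤ) {B c : Finset (Γ ⊕ Fin s)} (h : Disjoint B c)
    (hB : B.Nonempty) (hc : c.Nonempty) : blockFactor ε (B ∪ c) = 1 := by
  have h1 := hB.card_pos
  have h2 := hc.card_pos
  rw [blockFactor, if_neg]
  rw [Finset.card_union_of_disjoint h]
  omega

variable [Fintype Γ] {𝒜 : Subalgebra ℚ (X → ℚ)} {ε : X → Γ ⊕ Fin s → ℤ}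

/-- The central term from merging the two last blocks. -/
theorem exists_commConst (hs : 0 < s) (hε : ∀ i, (fun x => (ε x i : ℚ)) ∈ 𝒜)
    (htot : ∀ x, energy (ε x) Finset.univ = 0) {B c : Finset (Γ ⊕ Fin s)}
    (hBc : Disjoint B c) (hU : B ∪ c = Finset.univ) (hpos : ∀ x, 0 ≤ energy (ε x) B) :
    ∃ g, CoeffIn 𝒜 g ∧ ∀ x, commConst (energy (ε x) B) (energy (ε x) c) (B ∪ c).toRight =
      (blockFactor (ε x) B * blockFactor (ε x) c) • g x := by
  have hsum : ∀ x, energy (ε x) B + energy (ε x) c = 0 := fun x => by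
    rw [← energy_union hBc, hU, htot]
  have hB := energy_mem hε B
  obtain ⟨g, hg, hgx⟩ := exists_sum_expSum (B ∪ c).toRight hB hpos
  have hgx' : ∀ x, commConst (energy (ε x) B) (energy (ε x) c) (B ∪ c).toRight =
      (energy (ε x) B : ℚ) • g x := fun x => by rw [commConst, if_pos (hsum x), hgx]
  by_cases h1 : B.card = 1 ∧ B.toRight = ∅ <;> by_cases h2 : c.card = 1 ∧ c.toRight = ∅
  -- two operators `α` cannot be all the operators, as `s > 0`
  · have h3 : (⟨0, hs⟩ : Fin s) ∈ (B ∪ c).toRight := by rw [hU]; simp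
    rw [Finset.toRight_union, h1.2, h2.2] at h3
    simp at h3
  · refine ⟨g, hg, fun x => ?_⟩
    rw [hgx', blockFactor, if_pos h1, blockFactor, if_neg h2, mul_one]
  · refine ⟨_, CoeffIn.zero.sub hg, fun x => ?_⟩
    have : (energy (ε x) B : ℚ) = -(energy (ε x) c : ℚ) := by
      rw [eq_neg_iff_add_eq_zero]; exact_mod_cast hsum x
    rw [hgx', blockFactor, if_neg h1, blockFactor, if_pos h2, one_mul, zero_sub, smul_neg, this,
      neg_smul]
  · refine ⟨_, CoeffIn.smul hB hg, fun x => ?_⟩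
    rw [hgx', blockFactor, if_neg h1, blockFactor, if_neg h2, one_mul, one_smul]

/-- If the signs of all block energies are constant, and a block has energy zero
only for a trivial reason, then vacuum expectation values have coefficients in `𝒜`. -/
theorem exists_corr (hs : 0 < s) (hε : ∀ i, (fun x => (ε x i : ℚ)) ∈ 𝒜)
    (htot : ∀ x, energy (ε x) Finset.univ = 0)
    (hsign : ∀ B, (∀ x, 0 ≤ energy (ε x) B) ∨ ∀ x, energy (ε x) B ≤ 0)
    (hzero : ∀ x D, D.Nonempty → D ≠ Finset.univ → energy (ε x) D = 0 →
      (∀ B ⊆ D, energy (ε x) B = 0) ∨ ∀ B, Disjoint B D → energy (ε x) B = 0)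
    (L : List (Finset (Γ ⊕ Fin s))) (hL : IsPartitionList L) :
    ∃ g, CoeffIn 𝒜 g ∧ ∀ x, corr (ε x) L = (L.map (blockFactor (ε x))).prod • g x := by
  induction hN : L.length using Nat.strong_induction_on generalizing L with
  | _ N ih =>
  -- a block of nonnegative energy is moved to the right until it meets the vacuum
  have move : ∀ (C A : List (Finset (Γ ⊕ Fin s))) (B : Finset (Γ ⊕ Fin s)),
      (∀ x, 0 ≤ energy (ε x) B) → IsPartitionList (A ++ B :: C) → (A ++ B :: C).length = N →
      ∃ g, CoeffIn 𝒜 g ∧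
        ∀ x, corr (ε x) (A ++ B :: C) = ((A ++ B :: C).map (blockFactor (ε x))).prod • g x := by
    intro C
    induction C with
    | nil =>
      intro A B hB _ _
      exact ⟨_, CoeffIn.zero, fun x => by rw [corr_eq_zero_of_last (hB x), smul_zero]⟩
    | cons c C ihC =>
      intro A B hB hP hlen
      have hd := hP.disjoint
      have hBne : B.Nonempty := hP.1 B (by simp)
      have hcne : c.Nonempty := hP.1 c (by simp)
      obtain ⟨g₁, hg₁, h₁⟩ := ihC (A ++ [c]) B hB hP.swap (by simp at hlen ⊢; omega)
      obtain ⟨g₂, hg₂, h₂⟩ := ih (A ++ (B ∪ c) :: C).length (by simp at hlen ⊢; omega) _ hP.merge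
        rfl
      obtain ⟨f, hf, hfx⟩ := exists_commFactor hε B c
      obtain ⟨g₃, hg₃, h₃⟩ : ∃ g, CoeffIn 𝒜 g ∧ ∀ x,
          commConst (energy (ε x) B) (energy (ε x) c) (B ∪ c).toRight * corr (ε x) (A ++ C) =
            ((A ++ B :: c :: C).map (blockFactor (ε x))).prod • g x := by
        by_cases hU : B ∪ c = Finset.univ
        · obtain ⟨g, hg, hgx⟩ := exists_commConst hs hε htot hd hU hB
          have hnil := hP.eq_nil hU
          refine ⟨g, hg, fun x => ?_⟩
          rw [hnil, hgx, corr, List.map_nil, List.prod_nil, vev_one, mul_one]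
          rw [List.append_eq_nil_iff] at hnil
          simp [hnil.1, hnil.2]
        -- if the merged block is proper, the central term or the remaining expectation vanishes
        · refine ⟨_, CoeffIn.zero, fun x => ?_⟩
          rw [smul_zero]
          by_cases he : energy (ε x) B + energy (ε x) c = 0
          · rcases hzero x (B ∪ c) (hBne.mono Finset.subset_union_left) hU
              (by rw [energy_union hd, he]) with h | h
            · rw [commConst, h B Finset.subset_union_left]; simp
            · have hne := hP.ne_nil hU
              obtain ⟨D, L', hDL⟩ := List.exists_cons_of_ne_nil hne
              have hD : energy (ε x) D = 0 := h D (hP.disjoint_of_mem (by rw [hDL]; simp))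
              rw [hDL, corr_eq_zero_of_head hD.le, mul_zero]
          · rw [commConst, if_neg he, zero_mul]
      refine ⟨_, (hg₁.add (hf.mul hg₂)).add hg₃, fun x => ?_⟩
      have e1 : A ++ c :: B :: C = (A ++ [c]) ++ B :: C := by simp
      rw [corr_exchange hd (hB x), h₃, h₂, hfx, e1, h₁]
      simp only [List.map_append, List.map_cons, List.prod_append, List.prod_cons, List.map_nil,
        List.prod_nil, blockFactor_union _ hd hBne hcne, smul_mul_smul_comm, smul_add]
      congr 2
      · congr 1; ring
      · congr 1; ring
  cases L with
  | nil =>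
    have := hL.2 (Sum.inr ⟨0, hs⟩)
    simp at this
  | cons B L =>
    rcases hsign B with h | h
    · exact move L [] B h hL hN
    · exact ⟨_, CoeffIn.zero, fun x => by rw [corr_eq_zero_of_head (h x), smul_zero]⟩

end Algorithm

/-! ### Chambers and lattice points -/

section Chamber

variable {m n s : ℕ}

/-- The energies of the operators in the definition of the Hurwitz numbers. -/
def pointEnergy (s : ℕ) (μ : Fin m → ℕ) (ν : Fin n → ℕ) (k : ℤ) :
    (Fin m ⊕ Fin n) ⊕ Fin s → ℤ :=
  Sum.elim (Sum.elim (fun i => (μ i : ℤ)) fun j => -(ν j : ℤ)) fun _ => -k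

theorem energy_pointEnergy (μ : Fin m → ℕ) (ν : Fin n → ℕ) (k : ℤ)
    (B : Finset ((Fin m ⊕ Fin n) ⊕ Fin s)) :
    energy (pointEnergy s μ ν k) B = ∑ i ∈ B.toLeft.toLeft, (μ i : ℤ) -
      ∑ j ∈ B.toLeft.toRight, (ν j : ℤ) - k * (B.toRight.card : ℤ) := by
  have h : ∑ a ∈ B.toLeft, pointEnergy s μ ν k (Sum.inl a) = ∑ i ∈ B.toLeft.toLeft, (μ i : ℤ) -
      ∑ j ∈ B.toLeft.toRight, (ν j : ℤ) := by
    conv_lhs => rw [← Finset.toLeft_disjSum_toRight (u := B.toLeft)]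
    rw [Finset.sum_disjSum]
    simp [pointEnergy, sub_eq_add_neg]
  rw [energy]
  conv_lhs => rw [← Finset.toLeft_disjSum_toRight (u := B)]
  rw [Finset.sum_disjSum, h]
  simp [pointEnergy]
  ring

/-- The form of a wall has constant nonzero sign on a connected set which does not meet the wall. -/
theorem chamber_sign {C : Set (Triple m n)} (hC : IsChamber m n s C) (I : Finset (Fin m))
    (J : Finset (Fin n)) (t : ℕ) (ht : t ≤ s) (h₀ : ¬ (I = ∅ ∧ J = ∅))
    (h₁ : ¬ (I = Finset.univ ∧ J = Finset.univ)) :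
    (∀ p ∈ C, 0 < ∑ i ∈ I, p.1 i - ∑ j ∈ J, p.2.1 j - p.2.2 * (t : ℝ)) ∨
      ∀ p ∈ C, ∑ i ∈ I, p.1 i - ∑ j ∈ J, p.2.1 j - p.2.2 * (t : ℝ) < 0 := by
  obtain ⟨p₀, _, rfl⟩ := hC
  set f : Triple m n → ℝ := fun p => ∑ i ∈ I, p.1 i - ∑ j ∈ J, p.2.1 j - p.2.2 * (t : ℝ) with hf
  have hcont : Continuous f := by fun_prop
  have hne : ∀ p ∈ connectedComponentIn (wallComplement m n s) p₀, f p ≠ 0 := by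
    intro p hp h
    have hp' := connectedComponentIn_subset _ _ hp
    exact hp'.2 I J t h₀ h₁ ht ⟨hp'.1, h⟩
  by_contra! hcon
  obtain ⟨⟨p, hp, hfp⟩, q, hq, hfq⟩ := hcon
  obtain ⟨r, hr, hr0⟩ := isPreconnected_connectedComponentIn.intermediate_value hp hq
    hcont.continuousOn ⟨hfp, hfq⟩
  exact hne r hr hr0

/-- The energy of a block is the value of the linear form of a wall. -/
theorem toTriple_form (μ : Fin m → ℕ) (ν : Fin n → ℕ) (k : ℤ)
    (B : Finset ((Fin m ⊕ Fin n) ⊕ Fin s)) :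
    ((energy (pointEnergy s μ ν k) B : ℤ) : ℝ) =
      ∑ i ∈ B.toLeft.toLeft, (toTriple μ ν k).1 i - ∑ j ∈ B.toLeft.toRight,
        (toTriple μ ν k).2.1 j - (toTriple μ ν k).2.2 * (B.toRight.card : ℝ) := by
  rw [energy_pointEnergy]
  simp [toTriple]

theorem card_toRight_le (B : Finset ((Fin m ⊕ Fin n) ⊕ Fin s)) : B.toRight.card ≤ s := by
  simpa using Finset.card_le_univ B.toRight

theorem energy_of_empty (μ : Fin m → ℕ) (ν : Fin n → ℕ) (k : ℤ)
    {B : Finset ((Fin m ⊕ Fin n) ⊕ Fin s)} (h : B.toLeft.toLeft = ∅ ∧ B.toLeft.toRight = ∅) :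
    energy (pointEnergy s μ ν k) B = -(k * (B.toRight.card : ℤ)) := by
  rw [energy_pointEnergy, h.1, h.2]; simp

theorem energy_of_univ {μ : Fin m → ℕ} {ν : Fin n → ℕ} {k : ℤ} (hp : IsLatticePoint s μ ν k)
    {B : Finset ((Fin m ⊕ Fin n) ⊕ Fin s)}
    (h : B.toLeft.toLeft = Finset.univ ∧ B.toLeft.toRight = Finset.univ) :
    energy (pointEnergy s μ ν k) B = k * ((s : ℤ) - (B.toRight.card : ℤ)) := by
  rw [energy_pointEnergy, h.1, h.2, hp.2.2]; ring

/-- Over the lattice points of a chamber with `k` of constant sign, no block energy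
changes its sign. -/
theorem energy_sign {C : Set (Triple m n)} (hC : IsChamber m n s C)
    (B : Finset ((Fin m ⊕ Fin n) ⊕ Fin s)) {K : ℤ → Prop}
    (hK : (∀ k, K k → 0 ≤ k) ∨ ∀ k, K k → k ≤ 0) :
    (∀ μ ν k, IsLatticePoint s μ ν k → toTriple μ ν k ∈ C → K k →
        0 ≤ energy (pointEnergy s μ ν k) B) ∨
      ∀ μ ν k, IsLatticePoint s μ ν k → toTriple μ ν k ∈ C → K k →
        energy (pointEnergy s μ ν k) B ≤ 0 := by
  have hcard := card_toRight_le B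
  by_cases h₀ : B.toLeft.toLeft = ∅ ∧ B.toLeft.toRight = ∅
  · rcases hK with hK | hK
    · right
      intro μ ν k _ _ hk
      have := mul_nonneg (hK k hk) (Int.natCast_nonneg B.toRight.card)
      rw [energy_of_empty μ ν k h₀]; linarith
    · left
      intro μ ν k _ _ hk
      have := mul_nonneg (neg_nonneg.2 (hK k hk)) (Int.natCast_nonneg B.toRight.card)
      rw [energy_of_empty μ ν k h₀]; linarith
  by_cases h₁ : B.toLeft.toLeft = Finset.univ ∧ B.toLeft.toRight = Finset.univ
  · have h2 : (0 : ℤ) ≤ (s : ℤ) - (B.toRight.card : ℤ) := by omega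
    rcases hK with hK | hK
    · left
      intro μ ν k hp _ hk
      rw [energy_of_univ hp h₁]
      exact mul_nonneg (hK k hk) h2
    · right
      intro μ ν k hp _ hk
      rw [energy_of_univ hp h₁]
      exact mul_nonpos_of_nonpos_of_nonneg (hK k hk) h2
  · rcases chamber_sign hC _ _ _ hcard h₀ h₁ with h | h
    · left
      intro μ ν k _ hmem _
      have := h _ hmem
      rw [← toTriple_form] at this
      exact_mod_cast this.le
    · right
      intro μ ν k _ hmem _
      have := h _ hmem
      rw [← toTriple_form] at this
      exact_mod_cast this.le

/-- At a lattice point of a chamber, a proper block can have energy zero only for `k = 0`; it then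
either contains no operator `α`, or it contains all of them. -/
theorem energy_eq_zero {C : Set (Triple m n)} (hC : IsChamber m n s C) {μ : Fin m → ℕ}
    {ν : Fin n → ℕ} {k : ℤ} (hp : IsLatticePoint s μ ν k) (hmem : toTriple μ ν k ∈ C)
    {D : Finset ((Fin m ⊕ Fin n) ⊕ Fin s)} (hne : D.Nonempty) (hD : D ≠ Finset.univ)
    (h : energy (pointEnergy s μ ν k) D = 0) :
    (∀ B ⊆ D, energy (pointEnergy s μ ν k) B = 0) ∨
      ∀ B, Disjoint B D → energy (pointEnergy s μ ν k) B = 0 := by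
  have hcard := card_toRight_le D
  by_cases h₀ : D.toLeft.toLeft = ∅ ∧ D.toLeft.toRight = ∅
  · left
    have hk : k = 0 := by
      rw [energy_of_empty μ ν k h₀, neg_eq_zero, mul_eq_zero] at h
      refine h.resolve_right fun hc => ?_
      obtain ⟨(i | j) | p, hx⟩ := hne
      · have : i ∈ D.toLeft.toLeft := by simpa
        simp [h₀.1] at this
      · have : j ∈ D.toLeft.toRight := by simpa
        simp [h₀.2] at this
      · have : p ∈ D.toRight := by simpa
        rw [Nat.cast_eq_zero, Finset.card_eq_zero] at hc
        simp [hc] at this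
    intro B hB
    rw [energy_of_empty μ ν k, hk, zero_mul, neg_zero]
    constructor
    · rw [← Finset.subset_empty, ← h₀.1]
      exact Finset.toLeft_subset_toLeft (Finset.toLeft_subset_toLeft hB)
    · rw [← Finset.subset_empty, ← h₀.2]
      exact Finset.toRight_subset_toRight (Finset.toLeft_subset_toLeft hB)
  by_cases h₁ : D.toLeft.toLeft = Finset.univ ∧ D.toLeft.toRight = Finset.univ
  · right
    have hi : ∀ i, Sum.inl (Sum.inl i) ∈ D := fun i => by
      have : i ∈ D.toLeft.toLeft := by rw [h₁.1]; exact Finset.mem_univ i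
      simpa using this
    have hj : ∀ j, Sum.inl (Sum.inr j) ∈ D := fun j => by
      have : j ∈ D.toLeft.toRight := by rw [h₁.2]; exact Finset.mem_univ j
      simpa using this
    have hk : k = 0 := by
      rw [energy_of_univ hp h₁, mul_eq_zero] at h
      refine h.resolve_right fun hc => hD ?_
      have h3 : D.toRight = Finset.univ := by
        rw [← Finset.card_eq_iff_eq_univ, Fintype.card_fin]; omega
      ext ((i | j) | p)
      · simp [hi i]
      · simp [hj j]
      · have : p ∈ D.toRight := by rw [h3]; exact Finset.mem_univ p
        simpa using this
    intro B hB
    rw [Finset.disjoint_left] at hB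
    rw [energy_of_empty μ ν k, hk, zero_mul, neg_zero]
    constructor
    · refine Finset.eq_empty_of_forall_notMem fun i hiB => hB ?_ (hi i)
      simpa using hiB
    · refine Finset.eq_empty_of_forall_notMem fun j hjB => hB ?_ (hj j)
      simpa using hjB
  · exfalso
    rcases chamber_sign hC _ _ _ hcard h₀ h₁ with h' | h'
    · have := h' _ hmem
      rw [← toTriple_form, h] at this
      simp at this
    · have := h' _ hmem
      rw [← toTriple_form, h] at this
      simp at this

/-! ### The Hurwitz numbers as vacuum expectation values of block operators -/

/-- The factors in the definition of the Hurwitz numbers, as blocks of a single element. -/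
def singletonBlocks (m n s : ℕ) : List (Finset ((Fin m ⊕ Fin n) ⊕ Fin s)) :=
  (List.ofFn fun i => {Sum.inl (Sum.inl i)}) ++ (List.ofFn fun p => {Sum.inr p}) ++
    List.ofFn fun j => {Sum.inl (Sum.inr j)}

theorem isPartitionList_singletonBlocks : IsPartitionList (singletonBlocks m n s) := by
  refine ⟨fun B hB => ?_, fun t => ?_⟩
  · simp only [singletonBlocks, List.mem_append, List.mem_ofFn] at hB
    rcases hB with (⟨i, rfl⟩ | ⟨i, rfl⟩) | ⟨i, rfl⟩ <;> exact Finset.singleton_nonempty _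
  · have key : ∀ {N : ℕ} (i : Fin N), (List.finRange N).countP (fun j => i = j) = 1 := by
      intro N i
      have h := List.count_eq_one_of_mem (List.nodup_finRange N) (List.mem_finRange i)
      rw [List.count] at h
      rw [← h]
      refine List.countP_congr fun j _ => ?_
      simp only [beq_iff_eq, decide_eq_true_eq]
      exact eq_comm
    simp only [singletonBlocks, List.countP_append, List.ofFn_eq_map, List.countP_map]
    rcases t with (i | j) | p
    · simpa [Function.comp_def] using key i
    · simpa [Function.comp_def] using key j
    · simpa [Function.comp_def] using key p

theorem blockOp_empty (e : ℤ) : blockOp e (∅ : Finset (Fin s)) = alpha _ e := by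
  simp only [blockOp, alpha, expSum_empty]

theorem blockOp_singleton (e : ℤ) (p : Fin s) : blockOp e {p} = calE e p := by
  simp only [blockOp, calE, expSum, Finset.prod_singleton]

theorem energy_singleton {Γ : Type*} (ε : Γ ⊕ Fin s → ℤ) (t : Γ ⊕ Fin s) :
    energy ε {t} = ε t := Finset.sum_singleton _ _

theorem toRight_singleton_inl {Γ : Type*} (a : Γ) :
    ({Sum.inl a} : Finset (Γ ⊕ Fin s)).toRight = ∅ := by
  ext p; simp

theorem toRight_singleton_inr {Γ : Type*} (p : Fin s) :
    ({Sum.inr p} : Finset (Γ ⊕ Fin s)).toRight = {p} := by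
  ext q; simp

theorem hurwitz_eq_corr (r : ℕ) (μ : Fin m → ℕ) (ν : Fin n → ℕ) (k : ℤ) :
    hurwitz s r μ ν k = ((∏ i, (μ i : ℚ)) * ∏ j, (ν j : ℚ))⁻¹ *
      MvPowerSeries.coeff (Finsupp.equivFunOnFinite.symm fun _ : Fin s => r + 1)
        (corr (pointEnergy s μ ν k) (singletonBlocks m n s)) := by
  rw [hurwitz, corr, singletonBlocks]
  simp only [List.map_append, List.prod_append, List.map_ofFn, Function.comp_def,
    energy_singleton, toRight_singleton_inl, toRight_singleton_inr, blockOp_empty,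
    blockOp_singleton, pointEnergy, Sum.elim_inl, Sum.elim_inr]

theorem prod_blockFactor_singletonBlocks (μ : Fin m → ℕ) (ν : Fin n → ℕ) (k : ℤ) :
    ((singletonBlocks m n s).map (blockFactor (pointEnergy s μ ν k))).prod =
      (∏ i, (μ i : ℚ)) * ((-1) ^ n * ∏ j, (ν j : ℚ)) := by
  rw [singletonBlocks]
  simp only [List.map_append, List.prod_append, List.map_ofFn, Function.comp_def, blockFactor,
    energy_singleton, toRight_singleton_inl, toRight_singleton_inr, Finset.card_singleton,
    Finset.singleton_ne_empty, and_true, and_false, if_true, if_false, List.prod_ofFn,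
    pointEnergy, Sum.elim_inl, Sum.elim_inr, Finset.prod_const_one, mul_one]
  congr 1
  push_cast
  rw [Finset.prod_neg]
  simp

/-- Polynomiality over the lattice points of a chamber for which `k` has constant sign. -/
theorem exists_polynomial (r : ℕ) (hs : 1 ≤ s) {C : Set (Triple m n)} (hC : IsChamber m n s C)
    {K : ℤ → Prop} (hK : (∀ k, K k → 0 ≤ k) ∨ ∀ k, K k → k ≤ 0) :
    ∃ P : MvPolynomial (Fin m ⊕ Fin n ⊕ Unit) ℚ,
      ∀ (μ : Fin m → ℕ) (ν : Fin n → ℕ) (k : ℤ),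
        IsLatticePoint s μ ν k → toTriple μ ν k ∈ C → K k →
          hurwitz s r μ ν k = evalAt P μ ν k := by
  -- polynomiality is membership in the algebra `𝒜` of polynomial functions on the lattice points
  let X := {q : (Fin m → ℕ) × (Fin n → ℕ) × ℤ //
    IsLatticePoint s q.1 q.2.1 q.2.2 ∧ toTriple q.1 q.2.1 q.2.2 ∈ C ∧ K q.2.2}
  let coord : X → Fin m ⊕ Fin n ⊕ Unit → ℚ := fun x =>
    Sum.elim (fun i => (x.1.1 i : ℚ)) (Sum.elim (fun j => (x.1.2.1 j : ℚ)) fun _ => (x.1.2.2 : ℚ))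
  let 𝒜 : Subalgebra ℚ (X → ℚ) := (AlgHom.pi fun x : X => MvPolynomial.aeval (coord x)).range
  have hcoord : ∀ v, (fun x => coord x v) ∈ 𝒜 := fun v => by
    rw [AlgHom.mem_range]
    exact ⟨MvPolynomial.X v, by ext x; simp⟩
  let ε : X → (Fin m ⊕ Fin n) ⊕ Fin s → ℤ := fun x => pointEnergy s x.1.1 x.1.2.1 x.1.2.2
  have hε : ∀ t, (fun x => (ε x t : ℚ)) ∈ 𝒜 := by
    rintro ((i | j) | p)
    · simpa [ε, pointEnergy, coord] using hcoord (Sum.inl i)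
    · have := 𝒜.neg_mem (hcoord (Sum.inr (Sum.inl j)))
      have e : (fun x => (ε x (Sum.inl (Sum.inr j)) : ℚ)) =
          -fun x => coord x (Sum.inr (Sum.inl j)) := by ext x; simp [ε, pointEnergy, coord]
      rwa [e]
    · have := 𝒜.neg_mem (hcoord (Sum.inr (Sum.inr ())))
      have e : (fun x => (ε x (Sum.inr p) : ℚ)) =
          -fun x => coord x (Sum.inr (Sum.inr ())) := by ext x; simp [ε, pointEnergy, coord]
      rwa [e]
  have htot : ∀ x, energy (ε x) Finset.univ = 0 := fun x => by
    rw [energy_of_univ x.2.1 ⟨by ext; simp, by ext; simp⟩]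
    have : (Finset.univ : Finset ((Fin m ⊕ Fin n) ⊕ Fin s)).toRight = Finset.univ := by ext; simp
    simp [this]
  have hsign : ∀ B, (∀ x, 0 ≤ energy (ε x) B) ∨ ∀ x, energy (ε x) B ≤ 0 := fun B => by
    rcases energy_sign hC B hK with h | h
    · exact Or.inl fun x => h _ _ _ x.2.1 x.2.2.1 x.2.2.2
    · exact Or.inr fun x => h _ _ _ x.2.1 x.2.2.1 x.2.2.2
  obtain ⟨g, hg, hgx⟩ := exists_corr hs hε htot hsign
    (fun x D h1 h2 h3 => energy_eq_zero hC x.2.1 x.2.2.1 h1 h2 h3) _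
    isPartitionList_singletonBlocks
  obtain ⟨P, hP⟩ := (AlgHom.mem_range _).1
    (hg (Finsupp.equivFunOnFinite.symm fun _ : Fin s => r + 1))
  -- the sign comes from the energies `-ν_j` of the operators `α_{-ν_j}`
  refine ⟨MvPolynomial.C ((-1) ^ n) * P, fun μ ν k hp hmem hk => ?_⟩
  have h1 := hgx ⟨(μ, ν, k), hp, hmem, hk⟩
  have h2 := congrFun hP ⟨(μ, ν, k), hp, hmem, hk⟩
  have hμ : (∏ i, (μ i : ℚ)) ≠ 0 :=
    Finset.prod_ne_zero_iff.2 fun i _ => Nat.cast_ne_zero.2 (hp.1 i).ne'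
  have hν : (∏ j, (ν j : ℚ)) ≠ 0 :=
    Finset.prod_ne_zero_iff.2 fun j _ => Nat.cast_ne_zero.2 (hp.2.1 j).ne'
  rw [prod_blockFactor_singletonBlocks] at h1
  have h3 : MvPolynomial.eval (coord ⟨(μ, ν, k), hp, hmem, hk⟩) P = MvPowerSeries.coeff
      (Finsupp.equivFunOnFinite.symm fun _ : Fin s => r + 1) (g ⟨(μ, ν, k), hp, hmem, hk⟩) := by
    rw [← h2]
    simp [MvPolynomial.aeval_eq_eval]
  rw [hurwitz_eq_corr, h1, MvPowerSeries.coeff_smul, evalAt, map_mul, MvPolynomial.eval_C,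
    ← h3]
  change _ = (-1) ^ n * MvPolynomial.eval (coord ⟨(μ, ν, k), hp, hmem, hk⟩) P
  field_simp

end Chamber

end LeakyHurwitz

end

theorem mainTheorem2 (m n s r : ℕ) (hs : 1 ≤ s)
    (C : Set (LeakyHurwitz.Triple m n)) (hC : LeakyHurwitz.IsChamber m n s C) :
    (∃ P : MvPolynomial (Fin m ⊕ Fin n ⊕ Unit) ℚ,
      ∀ (μ : Fin m → ℕ) (ν : Fin n → ℕ) (k : ℤ),
        LeakyHurwitz.IsLatticePoint s μ ν k → LeakyHurwitz.toTriple μ ν k ∈ C → 0 ≤ k →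
          LeakyHurwitz.hurwitz s r μ ν k = LeakyHurwitz.evalAt P μ ν k) ∧
    (∃ Q : MvPolynomial (Fin m ⊕ Fin n ⊕ Unit) ℚ,
      ∀ (μ : Fin m → ℕ) (ν : Fin n → ℕ) (k : ℤ),
        LeakyHurwitz.IsLatticePoint s μ ν k → LeakyHurwitz.toTriple μ ν k ∈ C → k ≤ 0 →
          LeakyHurwitz.hurwitz s r μ ν k = LeakyHurwitz.evalAt Q μ ν k) :=
  ⟨LeakyHurwitz.exists_polynomial r hs hC (Or.inl fun _ h => h),
    LeakyHurwitz.exists_polynomial r hs hC (Or.inr fun _ h => h)⟩
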